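/- A *Fell bundle* over a discrete group $G$ is a family $\mathcal A=(A_t)_{t\in G}$ of complex Banach spaces with associative bilinear products $A_t\times A_s\to A_{ts}$ and conjugate-linear involutions $*:A_t\to A_{t^{-1}}$ such that $(ab)^*=b^*a^*$, $a^{**}=a$, $\|ab\|\le\|a\|\,\|b\|$, $\|a^*a\|=\|a\|^2$, and $a^*a\ge 0$ in the $C^*$-algebra $A_e$. Its full cross-sectional algebra $C^*(\mathcal A)$ is the enveloping $C^*$-algebra (the Hausdorff completion in the greatest $C^*$-seminorm) of the $*$-algebra $\bigoplus_{t\in G}A_t$ of finitely supported sections. For $C^*$-algebras $C,D$, write $C\otimes_{\max}D$ for the completion of the algebraic tensor product $C\odot D$ in the greatest $C^*$-seminorm $\|\cdot\|_{\max}$. Let $\mathcal A=(A_t)_{t\in G}$ and $\mathcal B=(B_s)_{s\in H}$ be Fell bundles over the discrete groups $G$ and $H$. Their maximal tensor product $\mathcal A\otimes_{\max}\mathcal B$ is the Fell bundle over $G\times H$ whose fiber at $(t,s)$ is the completion of $A_t\odot B_s$ in the norm $\|x\|=\|x^*x\|_{\max}^{1/2}$, where $x^*x\in A_e\odot B_e$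 and $\|\cdot\|_{\max}$ is the maximal $C^*$-norm on $A_e\odot B_e$, with the product and involution extending $(a\otimes b)(a'\otimes b')=aa'\otimes bb'$ and $(a\otimes b)^*=a^*\otimes b^*$. Then $C^*(\mathcal A\otimes_{\max}\mathcal B)$ and $C^*(\mathcal A)\otimes_{\max}C^*(\mathcal B)$ are canonically isomorphic: there is exactly one $*$-isomorphism $$\Phi:\ C^*(\mathcal A\otimes_{\max}\mathcal B)\ \longrightarrow\ C^*(\mathcal A)\otimes_{\max}C^*(\mathcal B)$$ such that, for all $t\in G$, $s\in H$, $a\in A_t$, $b\in B_s$, $\Phi$ maps the image of $a\otimes b\in A_t\otimes_{\max}B_s$ to $\iota(a)\otimes\iota(b)$, where $\iota$ denotes the canonical maps $A_t\to C^*(\mathcal A)$ and $B_s\to C^*(\mathcal B)$. -/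

import Mathlib

open scoped TensorProduct ComplexConjugate

set_option linter.unusedSectionVars false

universe u v u' v'

noncomputable section

/-! ### Hausdorff completion of a complex vector space with respect to a seminorm -/

/-- A copy of `E`, to carry the topology of the seminorm `p`. -/
def PreHull {E : Type*} [AddCommGroup E] [Module ℂ E] (_p : Seminorm ℂ E) : Type _ := E

namespace PreHull

variable {E : Type*} [AddCommGroup E] [Module ℂ E] (p : Seminorm ℂ E)

instance : SeminormedAddCommGroup (PreHull p) :=
  AddGroupSeminorm.toSeminormedAddCommGroup (E := E) p.toAddGroupSeminorm

instance : Module ℂ (PreHull p) := inferInstanceAs (Module ℂ E)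

instance : NormedSpace ℂ (PreHull p) where
  norm_smul_le c x := (p.smul' c x).le

end PreHull

/-- The Banach space obtained from `E` and the seminorm `p` by dividing out the null space of `p`
and completing. -/
abbrev Hull {E : Type*} [AddCommGroup E] [Module ℂ E] (p : Seminorm ℂ E) : Type _ :=
  UniformSpace.Completion (PreHull p)

namespace Hull

section

variable {E F K : Type*} [AddCommGroup E] [Module ℂ E] [AddCommGroup F] [Module ℂ F]
  [AddCommGroup K] [Module ℂ K]

/-- The canonical map of `E` to its completion with respect to `p`. -/
def mk (p : Seminorm ℂ E) : E →ₗ[ℂ] Hull p :=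
  (UniformSpace.Completion.toComplₗᵢ (𝕜 := ℂ) (E := PreHull p)).toLinearMap

theorem norm_mk (p : Seminorm ℂ E) (x : E) : ‖mk p x‖ = p x :=
  UniformSpace.Completion.norm_coe (E := PreHull p) x

theorem denseRange_mk (p : Seminorm ℂ E) : DenseRange (mk p) :=
  UniformSpace.Completion.denseRange_coe (α := PreHull p)

variable {p : Seminorm ℂ E} {q : Seminorm ℂ F} {r : Seminorm ℂ K}

theorem ind {P : Hull p → Prop} (hc : IsClosed {x | P x}) (h : ∀ x, P (mk p x)) (x : Hull p) :
    P x := (denseRange_mk p).induction_on x hc h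

theorem ind₂ {P : Hull p → Hull q → Prop} (hc : IsClosed {z : Hull p × Hull q | P z.1 z.2})
    (h : ∀ x y, P (mk p x) (mk q y)) (x : Hull p) (y : Hull q) : P x y :=
  ((denseRange_mk p).prodMap (denseRange_mk q)).induction_on (p := fun z => P z.1 z.2) (x, y) hc
    (fun z => h z.1 z.2)

/-- The continuous extension to the completions of a contractive conjugate-linear map. -/
def extendStar (f : E →ₗ⋆[ℂ] F) : Hull p →L⋆[ℂ] Hull q :=
  ((mk q).comp f).extendOfNorm (mk p)

theorem extendStar_mk (f : E →ₗ⋆[ℂ] F) (hf : ∀ x, q (f x) ≤ p x) (x : E) :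
    (extendStar f : Hull p →L⋆[ℂ] Hull q) (mk p x) = mk q (f x) :=
  LinearMap.extendOfNorm_eq (denseRange_mk p) ⟨1, fun x => by
    simpa [norm_mk] using hf x⟩ x

/-- The continuous extension to the completions of a contractive bilinear map. -/
def extend₂ (f : E →ₗ[ℂ] F →ₗ[ℂ] K) (hf : ∀ x y, r (f x y) ≤ p x * q y) :
    Hull p →L[ℂ] Hull q →L[ℂ] Hull r :=
  LinearMap.extendOfNorm
    { toFun := fun x => ((mk r).comp (f x)).extendOfNorm (mk q)
      map_add' := fun x x' => LinearMap.extendOfNorm_unique (denseRange_mk q) (p (x + x'))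
        (fun y => by simpa only [LinearMap.comp_apply, norm_mk] using hf (x + x') y) _ (by
          ext y
          have h := fun x : E => LinearMap.extendOfNorm_eq (f := (mk r).comp (f x))
            (denseRange_mk q) ⟨p x, fun y => by
              simpa only [LinearMap.comp_apply, norm_mk] using hf x y⟩ y
          simp [h])
      map_smul' := fun c x => LinearMap.extendOfNorm_unique (denseRange_mk q) (p (c • x))
        (fun y => by simpa only [LinearMap.comp_apply, norm_mk] using hf (c • x) y) _ (by
          ext y
          have h := fun x : E => LinearMap.extendOfNorm_eq (f := (mk r).comp (f x))
            (denseRange_mk q) ⟨p x, fun y => by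
              simpa only [LinearMap.comp_apply, norm_mk] using hf x y⟩ y
          simp [h]) } (mk p)

theorem extend₂_mk (f : E →ₗ[ℂ] F →ₗ[ℂ] K) (hf : ∀ x y, r (f x y) ≤ p x * q y) (x : E) (y : F) :
    (extend₂ f hf : Hull p →L[ℂ] Hull q →L[ℂ] Hull r) (mk p x) (mk q y) = mk r (f x y) := by
  have h := fun x : E => LinearMap.extendOfNorm_eq (f := (mk r).comp (f x))
    (denseRange_mk q) ⟨p x, fun y => by
      simpa only [LinearMap.comp_apply, norm_mk] using hf x y⟩
  unfold extend₂
  rw [LinearMap.extendOfNorm_eq (denseRange_mk p) ⟨1, fun x => ?_⟩]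
  · exact h x y
  · rw [one_mul, norm_mk]
    exact LinearMap.opNorm_extendOfNorm_le (denseRange_mk q) (apply_nonneg p x) (fun y => by
      simpa only [LinearMap.comp_apply, norm_mk] using hf x y)

end

end Hull

/-! ### C*-seminorms and enveloping C*-algebras of *-algebras -/

/-- A C*-seminorm on a complex *-algebra. -/
structure CStarSeminorm (S : Type*) [NonUnitalRing S] [StarRing S] [Module ℂ S] where
  /-- the underlying seminorm -/
  toSeminorm : Seminorm ℂ S
  map_mul_le : ∀ x y, toSeminorm (x * y) ≤ toSeminorm x * toSeminorm y
  map_star_mul_self : ∀ x, toSeminorm (star x * x) = toSeminorm x ^ 2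

namespace CStarSeminorm

variable {S : Type*} [NonUnitalRing S] [StarRing S] [Module ℂ S]

theorem map_star_le (p : CStarSeminorm S) (x : S) : p.toSeminorm (star x) ≤ p.toSeminorm x := by
  have h := p.map_star_mul_self (star x)
  have h2 := p.map_mul_le (star (star x)) (star x)
  rw [h, star_star] at h2
  rcases (apply_nonneg p.toSeminorm (star x)).eq_or_lt with h0 | h0
  · rw [← h0]; exact apply_nonneg _ _
  · exact le_of_mul_le_mul_right (by nlinarith) h0

theorem map_star (p : CStarSeminorm S) (x : S) : p.toSeminorm (star x) = p.toSeminorm x :=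
  le_antisymm (p.map_star_le x) (by simpa using p.map_star_le (star x))

instance : Inhabited (CStarSeminorm S) := ⟨⟨0, by simp, by simp⟩⟩

/-- The Hausdorff completion of a *-algebra with respect to a C*-seminorm. -/
def Completion (p : CStarSeminorm S) : Type _ := Hull p.toSeminorm

variable [IsScalarTower ℂ S S] [SMulCommClass ℂ S S] [StarModule ℂ S] (p : CStarSeminorm S)

namespace Completion

instance : NormedAddCommGroup p.Completion := inferInstanceAs (NormedAddCommGroup (Hull _))
instance : NormedSpace ℂ p.Completion := inferInstanceAs (NormedSpace ℂ (Hull _))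
instance : CompleteSpace p.Completion := inferInstanceAs (CompleteSpace (Hull _))

/-- The canonical map of the *-algebra to its completion. -/
def mk : S →ₗ[ℂ] p.Completion := Hull.mk p.toSeminorm

theorem norm_mk (x : S) : ‖mk p x‖ = p.toSeminorm x := Hull.norm_mk _ x

theorem denseRange_mk : DenseRange (mk p) := Hull.denseRange_mk _

/-- The extended product. -/
def mulL : p.Completion →L[ℂ] p.Completion →L[ℂ] p.Completion :=
  Hull.extend₂ (LinearMap.mul ℂ S) p.map_mul_le

/-- The extended involution. -/
def starL : p.Completion →L⋆[ℂ] p.Completion :=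
  Hull.extendStar (starLinearEquiv ℂ (A := S)).toLinearMap

instance : Mul p.Completion := ⟨fun x y => mulL p x y⟩
instance : Star p.Completion := ⟨fun x => starL p x⟩

theorem mk_mul (x y : S) : mk p (x * y) = mk p x * mk p y :=
  (Hull.extend₂_mk (LinearMap.mul ℂ S) p.map_mul_le x y).symm

theorem mk_star (x : S) : mk p (star x) = star (mk p x) :=
  (Hull.extendStar_mk (starLinearEquiv ℂ (A := S)).toLinearMap p.map_star_le x).symm

theorem continuous_mul' : Continuous fun z : p.Completion × p.Completion => z.1 * z.2 :=
  (mulL p).continuous₂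

theorem continuous_star' : Continuous fun z : p.Completion => star z := (starL p).continuous

instance : NonUnitalCStarAlgebra p.Completion where
  __ := (inferInstance : NormedAddCommGroup p.Completion)
  __ := (inferInstance : NormedSpace ℂ p.Completion)
  complete := CompleteSpace.complete
  left_distrib x y z := map_add (mulL p x) y z
  right_distrib x y z := by
    change mulL p (x + y) z = mulL p x z + mulL p y z
    simp
  zero_mul x := by change mulL p 0 x = 0; simp
  mul_zero x := map_zero (mulL p x)
  mul_assoc x y z := by
    have h := continuous_mul' p
    refine (denseRange_mk p).induction_on₃ (p := fun x y z => x * y * z = x * (y * z))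
      (isClosed_eq ?_ ?_) (fun x y z => by simp only [← mk_mul, mul_assoc]) x y z
    · exact h.comp₂ (h.comp₂ continuous_fst (continuous_fst.comp continuous_snd))
        (continuous_snd.comp continuous_snd)
    · exact h.comp₂ continuous_fst (h.comp continuous_snd)
  norm_mul_le x y := by
    refine (denseRange_mk p).induction_on₂ (p := fun x y => ‖x * y‖ ≤ ‖x‖ * ‖y‖)
      (isClosed_le (continuous_mul' p).norm (by fun_prop))
      (fun x y => by simpa only [← mk_mul, norm_mk] using p.map_mul_le x y) x y
  star_involutive x :=
    (denseRange_mk p).induction_on (p := fun x => star (star x) = x) x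
      (isClosed_eq ((continuous_star' p).comp (continuous_star' p)) continuous_id)
      (fun x => by simp only [← mk_star, star_star])
  star_mul x y := by
    have h := continuous_mul' p
    have hs := continuous_star' p
    refine (denseRange_mk p).induction_on₂ (p := fun x y => star (x * y) = star y * star x)
      (isClosed_eq (hs.comp h) (h.comp₂ (hs.comp continuous_snd) (hs.comp continuous_fst)))
      (fun x y => by simp only [← mk_mul, ← mk_star, star_mul]) x y
  star_add x y := map_add (starL p) x y
  norm_mul_self_le x := by
    have h := continuous_mul' p
    have hs := continuous_star' p
    refine (denseRange_mk p).induction_on (p := fun x => ‖x‖ * ‖x‖ ≤ ‖star x * x‖) x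
      (isClosed_le (by fun_prop) (h.comp₂ hs continuous_id).norm)
      (fun x => by
        rw [← mk_star, ← mk_mul, norm_mk, norm_mk, p.map_star_mul_self, sq])
  smul_assoc c x y := by change mulL p (c • x) y = c • mulL p x y; simp
  smul_comm c x y := ((mulL p x).map_smul c y).symm
  star_smul c x := (starL p).map_smulₛₗ c x

end Completion

theorem le_norm {A : Type*} [NonUnitalCStarAlgebra A] (p : CStarSeminorm A) (a : A) :
    p.toSeminorm a ≤ ‖a‖ := by
  let φ : A →⋆ₙₐ[ℂ] p.Completion :=
    { toFun := Completion.mk p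
      map_smul' := map_smul _
      map_zero' := map_zero _
      map_add' := map_add _
      map_mul' := Completion.mk_mul p
      map_star' := Completion.mk_star p }
  have := NonUnitalStarAlgHom.norm_apply_le φ a
  rwa [← Completion.norm_mk]

end CStarSeminorm

/-- The *-algebra `S` has an enveloping C*-algebra: the values at each element
of all C*-seminorms on `S` are bounded. -/
class HasEnvelope (S : Type*) [NonUnitalRing S] [StarRing S] [Module ℂ S] : Prop where
  bddAbove : ∀ x : S, BddAbove (Set.range fun p : CStarSeminorm S => p.toSeminorm x)

/-- The greatest C*-seminorm on a *-algebra. -/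
def CStarSeminorm.greatest (S : Type*) [NonUnitalRing S] [StarRing S] [Module ℂ S]
    [HasEnvelope S] : CStarSeminorm S where
  toSeminorm := Seminorm.of (fun x => ⨆ p : CStarSeminorm S, p.toSeminorm x)
    (fun x y => ciSup_le fun p => (map_add_le_add p.toSeminorm x y).trans
      (add_le_add (le_ciSup (HasEnvelope.bddAbove x) p) (le_ciSup (HasEnvelope.bddAbove y) p)))
    (fun c x => by simp only [map_smul_eq_mul, Real.mul_iSup_of_nonneg (norm_nonneg c)])
  map_mul_le x y := ciSup_le fun p => (p.map_mul_le x y).trans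
    (mul_le_mul (le_ciSup (HasEnvelope.bddAbove x) p) (le_ciSup (HasEnvelope.bddAbove y) p)
      (apply_nonneg _ _) ((apply_nonneg p.toSeminorm x).trans
        (le_ciSup (HasEnvelope.bddAbove x) p)))
  map_star_mul_self x := by
    change ⨆ p : CStarSeminorm S, p.toSeminorm (star x * x) =
      (⨆ p : CStarSeminorm S, p.toSeminorm x) ^ 2
    have h0 : 0 ≤ ⨆ p : CStarSeminorm S, p.toSeminorm x :=
      Real.iSup_nonneg fun p => apply_nonneg _ _
    apply le_antisymm
    · exact ciSup_le fun p => by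
        rw [p.map_star_mul_self]
        exact pow_le_pow_left₀ (apply_nonneg _ _) (le_ciSup (HasEnvelope.bddAbove x) p) 2
    · have hb := HasEnvelope.bddAbove (star x * x)
      have h1 : ⨆ p : CStarSeminorm S, p.toSeminorm x ≤
          √(⨆ p : CStarSeminorm S, p.toSeminorm (star x * x)) := ciSup_le fun p =>
        Real.le_sqrt_of_sq_le ((p.map_star_mul_self x).symm.le.trans (le_ciSup hb p))
      calc _ ≤ _ := pow_le_pow_left₀ h0 h1 2
        _ = _ := Real.sq_sqrt (Real.iSup_nonneg fun p => apply_nonneg _ _)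

theorem CStarSeminorm.le_greatest {S : Type*} [NonUnitalRing S] [StarRing S] [Module ℂ S]
    [HasEnvelope S] (p : CStarSeminorm S) (x : S) :
    p.toSeminorm x ≤ (CStarSeminorm.greatest S).toSeminorm x :=
  le_ciSup (HasEnvelope.bddAbove x) p

/-- The enveloping C*-algebra of a *-algebra: its Hausdorff completion with
respect to the greatest C*-seminorm. -/
abbrev Envelope (S : Type*) [NonUnitalRing S] [StarRing S] [Module ℂ S] [HasEnvelope S] : Type _ :=
  (CStarSeminorm.greatest S).Completion

/-! ### The maximal tensor product of C*-algebras -/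

theorem exists_unitization_defect {A : Type*} [NonUnitalCStarAlgebra A] (a : A) :
    ∃ (l : ℂ) (k : A), conj l * l = (‖a‖ : ℂ) ^ 2 ∧
      conj l • k + l • star k + star k * k = -(star a * a) := by
  let _ := CStarAlgebra.spectralOrder A
  have _ := CStarAlgebra.spectralOrderedRing A
  have h : 0 ≤ algebraMap ℝ (Unitization ℂ A) (‖a‖ ^ 2) - star (a : Unitization ℂ A) * a := by
    rw [sub_nonneg, ← Unitization.norm_inr (𝕜 := ℂ) a]
    exact CStarAlgebra.star_mul_le_algebraMap_norm_sq
  obtain ⟨b, hb⟩ := CStarAlgebra.nonneg_iff_eq_star_mul_self.mp h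
  refine ⟨b.fst, b.snd, ?_, ?_⟩
  · have := congrArg (fun z => z.fst) hb
    simpa [Unitization.algebraMap_eq_inl_comp, eq_comm, sub_eq_add_neg] using this
  · have := congrArg (fun z => z.snd) hb
    simpa [Unitization.algebraMap_eq_inl_comp, eq_comm, sub_eq_add_neg] using this

theorem action_bound {A X D : Type*} [NonUnitalCStarAlgebra A] [AddCommGroup X] [Module ℂ X]
    [NonUnitalCStarAlgebra D] [PartialOrder D] [StarOrderedRing D]
    (L : A →ₗ[ℂ] X →ₗ[ℂ] X) (hL : ∀ a b x, L (a * b) x = L a (L b x))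
    (I : X →ₗ⋆[ℂ] X →ₗ[ℂ] D) (hI : ∀ a x y, I (L a x) y = I x (L (star a) y))
    (hpos : ∀ x, 0 ≤ I x x) (a : A) (x : X) :
    ‖I (L a x) (L a x)‖ ≤ ‖a‖ ^ 2 * ‖I x x‖ := by
  obtain ⟨l, k, h1, h2⟩ := exists_unitization_defect a
  have h3 : I (l • x + L k x) (l • x + L k x) = (‖a‖ : ℂ) ^ 2 • I x x - I (L a x) (L a x) := by
    have e1 : I (L a x) (L a x) = I x (L (star a * a) x) := by rw [hI, hL]
    have e2 := congrArg (fun z => I x (L z x)) h2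
    simp only [map_add, map_smul, map_neg, LinearMap.add_apply, LinearMap.smul_apply, hL,
      LinearMap.neg_apply] at e2
    rw [e1, hL, ← h1]
    simp only [map_add, map_smulₛₗ, LinearMap.add_apply, LinearMap.smul_apply, hI, RingHom.id_apply,
      smul_add, smul_smul]
    rw [sub_eq_add_neg, ← e2, mul_comm l]
    abel
  have h4 : I (L a x) (L a x) ≤ (‖a‖ ^ 2) • I x x := by
    have := hpos (l • x + L k x)
    rw [h3, sub_nonneg] at this
    convert this using 1
    rw [← Complex.ofReal_pow, Complex.coe_smul]
  calc _ ≤ ‖(‖a‖ ^ 2) • I x x‖ := CStarAlgebra.norm_le_norm_of_nonneg_of_le (hpos _) h4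
    _ = _ := by rw [norm_smul]; simp

/-- The sesquilinear form `(x, y) ↦ x* y` on a *-algebra, with values in a C*-completion. -/
def CStarSeminorm.form {S : Type*} [NonUnitalRing S] [StarRing S] [Module ℂ S]
    [IsScalarTower ℂ S S] [SMulCommClass ℂ S S] [StarModule ℂ S] (p : CStarSeminorm S) :
    S →ₗ⋆[ℂ] S →ₗ[ℂ] p.Completion :=
  LinearMap.mk₂'ₛₗ _ _ (fun x y => CStarSeminorm.Completion.mk p (star x * y))
    (fun x y z => by simp [add_mul]) (fun c x y => by simp [smul_mul_assoc])
    (fun x y z => by simp [mul_add]) (fun c x y => by simp [mul_smul_comm])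

theorem CStarSeminorm.sq_eq_norm_form {S : Type*} [NonUnitalRing S] [StarRing S] [Module ℂ S]
    [IsScalarTower ℂ S S] [SMulCommClass ℂ S S] [StarModule ℂ S] (p : CStarSeminorm S) (x : S) :
    p.toSeminorm x ^ 2 = ‖p.form x x‖ := by
  rw [← p.map_star_mul_self]
  exact (CStarSeminorm.Completion.norm_mk p _).symm

section

variable {A B : Type*} [NonUnitalCStarAlgebra A] [NonUnitalCStarAlgebra B]

theorem CStarSeminorm.mul_left_bound (p : CStarSeminorm (A ⊗[ℂ] B)) {C : Type*}
    [NonUnitalCStarAlgebra C] (L : C →ₗ[ℂ] A ⊗[ℂ] B →ₗ[ℂ] A ⊗[ℂ] B)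
    (hL : ∀ a b x, L (a * b) x = L a (L b x))
    (hI : ∀ a x y, star (L a x) * y = star x * (L (star a) y)) (c : C) (x : A ⊗[ℂ] B) :
    p.toSeminorm (L c x) ≤ ‖c‖ * p.toSeminorm x := by
  let _ := CStarAlgebra.spectralOrder p.Completion
  have _ := CStarAlgebra.spectralOrderedRing p.Completion
  have h := action_bound L hL p.form
    (fun a x y => congrArg (CStarSeminorm.Completion.mk p) (hI a x y))
    (fun x => by
      change 0 ≤ CStarSeminorm.Completion.mk p (star x * x)
      rw [CStarSeminorm.Completion.mk_mul, CStarSeminorm.Completion.mk_star]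
      exact star_mul_self_nonneg _) c x
  rw [← p.sq_eq_norm_form, ← p.sq_eq_norm_form, ← mul_pow] at h
  exact le_of_sq_le_sq h (by positivity)

theorem CStarSeminorm.map_tmul_le (p : CStarSeminorm (A ⊗[ℂ] B)) (a : A) (b : B) :
    p.toSeminorm (a ⊗ₜ b) ≤ ‖a‖ * ‖b‖ := by
  have hA : ∀ (a a' : A) (b : B), p.toSeminorm ((a * a') ⊗ₜ b) ≤ ‖a‖ * p.toSeminorm (a' ⊗ₜ b) :=
    fun a a' b => p.mul_left_bound
      ((TensorProduct.mapBilinear (RingHom.id ℂ) A B A B).flip LinearMap.id ∘ₗ LinearMap.mul ℂ A)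
      (fun a b x => by
        induction x with
        | zero => simp
        | tmul x y => simp [mul_assoc]
        | add x y hx hy => simp only [map_add, hx, hy])
      (fun a x y => by
        induction x with
        | zero => simp
        | add x x' hx hy => simp only [map_add, star_add, add_mul, hx, hy]
        | tmul x x' =>
          induction y with
          | zero => simp
          | tmul y y' => simp [mul_assoc]
          | add x y hx hy => simp only [map_add, mul_add, hx, hy]) a (a' ⊗ₜ b)
  have hB : ∀ (a : A) (b b' : B), p.toSeminorm (a ⊗ₜ (b * b')) ≤ ‖b‖ * p.toSeminorm (a ⊗ₜ b') :=
    fun a b b' => p.mul_left_bound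
      (TensorProduct.mapBilinear (RingHom.id ℂ) A B A B LinearMap.id ∘ₗ LinearMap.mul ℂ B)
      (fun a b x => by
        induction x with
        | zero => simp
        | tmul x y => simp [mul_assoc]
        | add x y hx hy => simp only [map_add, hx, hy])
      (fun a x y => by
        induction x with
        | zero => simp
        | add x x' hx hy => simp only [map_add, star_add, add_mul, hx, hy]
        | tmul x x' =>
          induction y with
          | zero => simp
          | tmul y y' => simp [mul_assoc]
          | add x y hx hy => simp only [map_add, mul_add, hx, hy]) b (a ⊗ₜ b')
  have h1 := p.map_star_mul_self (star a ⊗ₜ[ℂ] star b * a ⊗ₜ[ℂ] b)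
  have h2 : p.toSeminorm ((star a * a) ⊗ₜ[ℂ] (star b * b)) = p.toSeminorm (a ⊗ₜ b) ^ 2 := by
    simpa using p.map_star_mul_self (a ⊗ₜ b)
  have h3 : p.toSeminorm ((star a * a * (star a * a)) ⊗ₜ[ℂ] (star b * b * (star b * b))) =
      p.toSeminorm ((star a * a) ⊗ₜ[ℂ] (star b * b)) ^ 2 := by
    simpa using p.map_star_mul_self ((star a * a) ⊗ₜ[ℂ] (star b * b))
  have h4 := (hA (star a * a) (star a * a) (star b * b * (star b * b))).trans
    (mul_le_mul_of_nonneg_left (hB (star a * a) (star b * b) (star b * b)) (norm_nonneg _))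
  rw [h3, h2, CStarRing.norm_star_mul_self, CStarRing.norm_star_mul_self] at h4
  set r := p.toSeminorm (a ⊗ₜ[ℂ] b)
  have hr : 0 ≤ r := apply_nonneg _ _
  by_contra! hlt
  have hM : 0 ≤ ‖a‖ * ‖b‖ := by positivity
  have hr0 : 0 < r := lt_of_le_of_lt hM hlt
  have : r ^ 2 * r ^ 2 ≤ (‖a‖ * ‖b‖) ^ 2 * r ^ 2 := by nlinarith
  have := le_of_mul_le_mul_right this (by positivity)
  nlinarith

instance : HasEnvelope (A ⊗[ℂ] B) where
  bddAbove x := by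
    induction x with
    | zero => exact ⟨0, by rintro _ ⟨p, rfl⟩; simp⟩
    | tmul a b => exact ⟨‖a‖ * ‖b‖, by rintro _ ⟨p, rfl⟩; exact p.map_tmul_le a b⟩
    | add x y hx hy =>
      obtain ⟨c, hc⟩ := hx
      obtain ⟨d, hd⟩ := hy
      exact ⟨c + d, by
        rintro _ ⟨p, rfl⟩
        exact (map_add_le_add p.toSeminorm x y).trans (add_le_add (hc ⟨p, rfl⟩) (hd ⟨p, rfl⟩))⟩

end

/-- The maximal tensor product of two C*-algebras: the completion of the algebraic tensor product
with respect to the greatest C*-seminorm. -/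
abbrev MaxTensorProduct (A B : Type*) [NonUnitalCStarAlgebra A] [NonUnitalCStarAlgebra B] :
    Type _ := Envelope (A ⊗[ℂ] B)

/-- The canonical image of an element of the algebraic tensor product in the maximal one. -/
def MaxTensorProduct.mk (A B : Type*) [NonUnitalCStarAlgebra A] [NonUnitalCStarAlgebra B] :
    A ⊗[ℂ] B →ₗ[ℂ] MaxTensorProduct A B :=
  CStarSeminorm.Completion.mk (CStarSeminorm.greatest (A ⊗[ℂ] B))

/-! ### Fell bundles over discrete groups -/

/-- A Fell bundle over the discrete group `G`: a family of complex Banach spaces `A_t` with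
bilinear products `A_t × A_s → A_{ts}` and conjugate-linear involutions `A_t → A_{t⁻¹}`. In order
to avoid transports between equal fibers, the product is indexed by the equations `t * s = r` and
the involution by the equations `t⁻¹ = r`. A positive element of the C*-algebra `A_1` is one of the
form `c* c`, with `c` in `A_1`. -/
structure FellBundle (G : Type u) [Group G] where
  /-- the fibers -/
  fiber : G → Type v
  [normedAddCommGroup : ∀ t, NormedAddCommGroup (fiber t)]
  [normedSpace : ∀ t, NormedSpace ℂ (fiber t)]
  [completeSpace : ∀ t, CompleteSpace (fiber t)]
  /-- the product -/
  mul : ∀ {t s r : G}, t * s = r → fiber t →ₗ[ℂ] fiber s →ₗ[ℂ] fiber r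
  /-- the involution -/
  invol : ∀ {t r : G}, t⁻¹ = r → fiber t →ₗ⋆[ℂ] fiber r
  mul_assoc' : ∀ {t s r x y z : G} (h₁ : t * s = x) (h₂ : x * r = z) (h₃ : s * r = y)
    (h₄ : t * y = z) (a : fiber t) (b : fiber s) (c : fiber r),
    mul h₂ (mul h₁ a b) c = mul h₄ a (mul h₃ b c)
  invol_mul' : ∀ {t s r t' s' r' : G} (h : t * s = r) (hr : r⁻¹ = r') (ht : t⁻¹ = t')
    (hs : s⁻¹ = s') (h' : s' * t' = r') (a : fiber t) (b : fiber s),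
    invol hr (mul h a b) = mul h' (invol hs b) (invol ht a)
  invol_invol' : ∀ {t r : G} (h : t⁻¹ = r) (h' : r⁻¹ = t) (a : fiber t), invol h' (invol h a) = a
  norm_mul_le' : ∀ {t s r : G} (h : t * s = r) (a : fiber t) (b : fiber s),
    ‖mul h a b‖ ≤ ‖a‖ * ‖b‖
  norm_invol_mul_self : ∀ {t r : G} (h : t⁻¹ = r) (h' : r * t = 1) (a : fiber t),
    ‖mul h' (invol h a) a‖ = ‖a‖ ^ 2
  invol_mul_self_nonneg : ∀ {t r : G} (h : t⁻¹ = r) (h' : r * t = 1) (a : fiber t),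
    ∃ c : fiber 1, mul h' (invol h a) a = mul (mul_one 1) (invol inv_one c) c

namespace FellBundle

attribute [instance] normedAddCommGroup normedSpace completeSpace

variable {G : Type u} [Group G] (A : FellBundle.{u, v} G)

theorem norm_invol_le {t r : G} (h : t⁻¹ = r) (a : A.fiber t) : ‖a‖ ≤ ‖A.invol h a‖ := by
  have h' : r * t = 1 := by rw [← h, inv_mul_cancel]
  have h1 := A.norm_invol_mul_self h h' a
  have h2 := A.norm_mul_le' h' (A.invol h a) a
  rw [h1] at h2
  rcases (norm_nonneg a).eq_or_lt with h0 | h0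
  · rw [← h0]; exact norm_nonneg _
  · exact le_of_mul_le_mul_right (by nlinarith) h0

theorem norm_invol {t r : G} (h : t⁻¹ = r) (a : A.fiber t) : ‖A.invol h a‖ = ‖a‖ := by
  have h' : r⁻¹ = t := by rw [← h, inv_inv]
  refine le_antisymm ?_ (A.norm_invol_le h a)
  simpa [A.invol_invol' h h'] using A.norm_invol_le h' (A.invol h a)

/-- The unit fiber of a Fell bundle, as a C*-algebra. -/
def UnitFiber : Type v := A.fiber 1

namespace UnitFiber

instance : NormedAddCommGroup A.UnitFiber := inferInstanceAs (NormedAddCommGroup (A.fiber 1))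
instance : NormedSpace ℂ A.UnitFiber := inferInstanceAs (NormedSpace ℂ (A.fiber 1))
instance : CompleteSpace A.UnitFiber := inferInstanceAs (CompleteSpace (A.fiber 1))
instance : Mul A.UnitFiber := ⟨fun a b => A.mul (mul_one 1) a b⟩
instance : Star A.UnitFiber := ⟨fun a => A.invol inv_one a⟩

theorem mul_def (a b : A.UnitFiber) : a * b = A.mul (mul_one 1) a b := rfl
theorem star_def (a : A.UnitFiber) : star a = A.invol inv_one a := rfl

instance : NonUnitalCStarAlgebra A.UnitFiber where
  __ := (inferInstance : NormedAddCommGroup A.UnitFiber)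
  __ := (inferInstance : NormedSpace ℂ A.UnitFiber)
  complete := CompleteSpace.complete
  left_distrib a b c := map_add (A.mul (mul_one 1) a) b c
  right_distrib a b c := LinearMap.map_add₂ (A.mul (mul_one 1)) a b c
  zero_mul a := LinearMap.map_zero₂ (A.mul (mul_one 1)) a
  mul_zero a := map_zero (A.mul (mul_one 1) a)
  mul_assoc a b c := A.mul_assoc' _ _ _ _ a b c
  norm_mul_le a b := A.norm_mul_le' _ a b
  star_involutive a := A.invol_invol' _ _ a
  star_mul a b := A.invol_mul' _ _ _ _ _ a b
  star_add a b := map_add (A.invol inv_one) a b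
  norm_mul_self_le a := ((A.norm_invol_mul_self inv_one (mul_one 1) a).trans (sq _)).ge
  smul_assoc c a b := LinearMap.map_smul₂ (A.mul (mul_one 1)) c a b
  smul_comm c a b := (map_smul (A.mul (mul_one 1) a) c b).symm
  star_smul c a := map_smulₛₗ (A.invol inv_one) c a

end UnitFiber

/-! ### The *-algebra of finitely supported sections and the full cross-sectional C*-algebra -/

/-- The finitely supported sections of a Fell bundle. -/
def Sections : Type (max u v) := DirectSum G A.fiber

namespace Sections

instance : AddCommGroup A.Sections := inferInstanceAs (AddCommGroup (DirectSum G A.fiber))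
instance : Module ℂ A.Sections := inferInstanceAs (Module ℂ (DirectSum G A.fiber))

open scoped Classical in
/-- The section with value `a` at `t` and zero elsewhere. -/
def single (t : G) : A.fiber t →ₗ[ℂ] A.Sections := DirectSum.lof ℂ G A.fiber t

@[elab_as_elim]
theorem ind {P : A.Sections → Prop} (x : A.Sections) (h0 : P 0)
    (hs : ∀ t a, P (single A t a)) (ha : ∀ x y, P x → P y → P (x + y)) : P x := by
  classical
  exact DirectSum.induction_on (motive := P) x h0 hs ha

open scoped Classical in
/-- The linear map on sections with given restrictions to the fibers. -/
def lift {V : Type*} [AddCommGroup V] [Module ℂ V] (f : ∀ t, A.fiber t →ₗ[ℂ] V) :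
    A.Sections →ₗ[ℂ] V := DirectSum.toModule ℂ G V f

theorem lift_single {V : Type*} [AddCommGroup V] [Module ℂ V] (f : ∀ t, A.fiber t →ₗ[ℂ] V)
    (t : G) (a : A.fiber t) : lift A f (single A t a) = f t a := by
  classical
  exact DirectSum.toModule_lof (ι := G) (M := A.fiber) ℂ t a

open scoped Classical in
/-- The additive map on sections with given restrictions to the fibers. -/
def liftAdd {V : Type*} [AddCommGroup V] (f : ∀ t, A.fiber t →+ V) : A.Sections →+ V :=
  DirectSum.toAddMonoid f

theorem liftAdd_single {V : Type*} [AddCommGroup V] (f : ∀ t, A.fiber t →+ V)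
    (t : G) (a : A.fiber t) : liftAdd A f (single A t a) = f t a := by
  classical
  exact DirectSum.toAddMonoid_of (β := A.fiber) f t a

/-- The convolution product of sections. -/
def mulHom : A.Sections →ₗ[ℂ] A.Sections →ₗ[ℂ] A.Sections :=
  lift A fun t => LinearMap.flip (lift A fun s =>
    LinearMap.flip ((A.mul (rfl : t * s = t * s)).compr₂ (single A (t * s))))

/-- The involution of sections. -/
def starHom : A.Sections →ₗ⋆[ℂ] A.Sections :=
  { toFun := liftAdd A fun t => ((single A t⁻¹).comp (A.invol (rfl : t⁻¹ = t⁻¹))).toAddMonoidHom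
    map_add' := map_add _
    map_smul' := fun c x => by
      refine ind A x ?_ ?_ ?_
      · simp
      · intro t a
        rw [← map_smul, liftAdd_single, liftAdd_single]
        exact map_smulₛₗ ((single A t⁻¹).comp (A.invol rfl)) c a
      · intro x y hx hy
        rw [smul_add, map_add, hx, hy, map_add, smul_add] }

instance : Mul A.Sections := ⟨fun x y => mulHom A x y⟩
instance : Star A.Sections := ⟨fun x => starHom A x⟩

theorem single_mul {t s r : G} (h : t * s = r) (a : A.fiber t) (b : A.fiber s) :
    single A t a * single A s b = single A r (A.mul h a b) := by
  subst h
  change mulHom A (single A t a) (single A s b) = _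
  simp [mulHom, lift_single]

theorem star_single {t r : G} (h : t⁻¹ = r) (a : A.fiber t) :
    star (single A t a) = single A r (A.invol h a) := by
  subst h
  change starHom A (single A t a) = _
  exact liftAdd_single A (fun t =>
    ((single A t⁻¹).comp (A.invol (rfl : t⁻¹ = t⁻¹))).toAddMonoidHom) t a

instance : NonUnitalNonAssocRing A.Sections where
  left_distrib x y z := map_add (mulHom A x) y z
  right_distrib x y z := LinearMap.map_add₂ (mulHom A) x y z
  zero_mul x := LinearMap.map_zero₂ (mulHom A) x
  mul_zero x := map_zero (mulHom A x)

instance : NonUnitalRing A.Sections where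
  mul_assoc x y z := by
    refine ind A x (by simp) (fun t a => ?_) (fun x x' hx hx' => by simp only [add_mul, hx, hx'])
    refine ind A y (by simp) (fun s b => ?_)
      (fun x x' hx hx' => by simp only [add_mul, mul_add, hx, hx'])
    refine ind A z (by simp) (fun r c => ?_) (fun x x' hx hx' => by simp only [mul_add, hx, hx'])
    rw [single_mul A rfl, single_mul A rfl, single_mul A rfl, single_mul A (mul_assoc t s r).symm,
      A.mul_assoc']

instance : StarRing A.Sections where
  star_involutive x := by
    refine ind A x ?_ (fun t a => ?_) (fun x y hx hy => ?_)
    · exact (congrArg (starHom A) (map_zero (starHom A))).trans (map_zero (starHom A))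
    · rw [star_single A rfl, star_single A (inv_inv t), A.invol_invol']
    · exact (congrArg (starHom A) (map_add (starHom A) x y)).trans
        ((map_add (starHom A) _ _).trans (congrArg₂ (· + ·) hx hy))
  star_add x y := map_add (starHom A) x y
  star_mul x y := by
    have hadd : ∀ x y : A.Sections, star (x + y) = star x + star y := map_add (starHom A)
    have h0 : star (0 : A.Sections) = 0 := map_zero (starHom A)
    refine ind A x (by simp [h0]) (fun t a => ?_)
      (fun x x' hx hx' => by simp only [add_mul, mul_add, hadd, hx, hx'])
    refine ind A y (by simp [h0]) (fun s b => ?_)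
      (fun x x' hx hx' => by simp only [add_mul, mul_add, hadd, hx, hx'])
    rw [single_mul A rfl, star_single A rfl, star_single A rfl, star_single A rfl,
      single_mul A (mul_inv_rev t s).symm, A.invol_mul']

instance : IsScalarTower ℂ A.Sections A.Sections :=
  ⟨fun c x y => LinearMap.map_smul₂ (mulHom A) c x y⟩

instance : SMulCommClass ℂ A.Sections A.Sections :=
  ⟨fun c x y => (map_smul (mulHom A x) c y).symm⟩

instance : StarModule ℂ A.Sections := ⟨fun c x => map_smulₛₗ (starHom A) c x⟩

theorem seminorm_single_le (p : CStarSeminorm A.Sections) (t : G) (a : A.fiber t) :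
    p.toSeminorm (single A t a) ≤ ‖a‖ := by
  let q : CStarSeminorm A.UnitFiber :=
    { toSeminorm := p.toSeminorm.comp (single A 1)
      map_mul_le := fun x y => by
        have := p.map_mul_le (single A 1 x) (single A 1 y)
        rwa [single_mul A (mul_one 1) (x : A.fiber 1) (y : A.fiber 1)] at this
      map_star_mul_self := fun x => by
        have := p.map_star_mul_self (single A 1 x)
        rwa [star_single A inv_one (x : A.fiber 1),
          single_mul A (mul_one 1) _ (x : A.fiber 1)] at this }
  have h1 := p.map_star_mul_self (single A t a)
  rw [star_single A rfl, single_mul A (inv_mul_cancel t)] at h1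
  have h2 := q.le_norm (A.mul (inv_mul_cancel t) (A.invol rfl a) a : A.fiber 1)
  have h3 : p.toSeminorm (single A t a) ^ 2 ≤ ‖a‖ ^ 2 := by
    rw [← h1, ← A.norm_invol_mul_self rfl (inv_mul_cancel t)]
    exact h2
  exact le_of_sq_le_sq h3 (norm_nonneg _)

instance : HasEnvelope A.Sections where
  bddAbove x := by
    refine ind A x ⟨0, ?_⟩ (fun t a => ⟨‖a‖, ?_⟩) (fun x y hx hy => ?_)
    · rintro _ ⟨p, rfl⟩; simp
    · rintro _ ⟨p, rfl⟩; exact seminorm_single_le A p t a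
    · obtain ⟨c, hc⟩ := hx
      obtain ⟨d, hd⟩ := hy
      refine ⟨c + d, ?_⟩
      rintro _ ⟨p, rfl⟩
      exact (map_add_le_add p.toSeminorm x y).trans (add_le_add (hc ⟨p, rfl⟩) (hd ⟨p, rfl⟩))

end Sections

/-- The full cross-sectional C*-algebra `C*(A)`: the enveloping C*-algebra of the *-algebra of
finitely supported sections. -/
abbrev FullCStar : Type (max u v) := Envelope A.Sections

/-- The canonical map of the fiber `A_t` to `C*(A)`. -/
def toFullCStar (t : G) : A.fiber t →ₗ[ℂ] A.FullCStar :=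
  (CStarSeminorm.Completion.mk (CStarSeminorm.greatest A.Sections)).comp (Sections.single A t)

end FellBundle

/-! ### Positivity in Fell bundles -/

theorem exists_local_unit {C : Type*} [NonUnitalCStarAlgebra C] [PartialOrder C]
    [StarOrderedRing C] (h : C) (hh : 0 ≤ h) (δ : ℝ) (hδ : 0 < δ) :
    ∃ g : C, star g = g ∧ ∀ k : C, 0 ≤ k → k ≤ h →
      ‖k - g * h * g * k - k * (g * h * g) + g * h * g * k * (g * h * g)‖ ≤ δ := by
  have hm : ∀ r : ℝ, 0 < max δ r := fun r => lt_max_of_lt_left hδ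
  let γ : ℝ → ℝ := fun r => r / √(max δ r) ^ 3
  let f : ℝ → ℝ := fun r => γ r * r * γ r
  have hγ : Continuous γ := by
    refine continuous_id.div (by fun_prop) fun r => ?_
    have := Real.sqrt_pos.mpr (hm r)
    positivity
  have hγ0 : γ 0 = 0 := by simp [γ]
  have hf : Continuous f := by fun_prop
  have hf0 : f 0 = 0 := by simp [f]
  have hf' : ∀ r, f r = r ^ 3 / max δ r ^ 3 := fun r => by
    have h1 := Real.sqrt_pos.mpr (hm r)
    have h2 := Real.sq_sqrt (hm r).le
    simp only [f, γ]
    rw [← h2]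
    field_simp
    rw [Real.sqrt_sq h1.le]
  have hsa : IsSelfAdjoint h := .of_nonneg hh
  have he : cfcₙ γ h * h * cfcₙ γ h = cfcₙ f h := by
    conv_lhs => rw [← cfcₙ_id' ℝ h]
    rw [cfcₙ_id' ℝ h]
    have h1 : cfcₙ γ h * h = cfcₙ (fun r => γ r * r) h := by
      rw [cfcₙ_mul γ (fun r => r) h (by fun_prop) hγ0 (by fun_prop) rfl, cfcₙ_id' ℝ h]
    rw [h1, ← cfcₙ_mul (fun r => γ r * r) γ h (by fun_prop) (by simp) (by fun_prop) hγ0]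
  refine ⟨cfcₙ γ h, cfcₙ_predicate γ h, fun k hk hkh => ?_⟩
  rw [he]
  set e := cfcₙ f h with hedef
  have hes : star e = e := cfcₙ_predicate f h
  have key : ∀ x : C, 0 ≤ x → 0 ≤ x - e * x - x * e + e * x * e := fun x hx => by
    obtain ⟨d, rfl⟩ := CStarAlgebra.nonneg_iff_eq_star_mul_self.mp hx
    have := star_mul_self_nonneg (d - d * e)
    convert this using 1
    simp only [star_sub, star_mul, hes, mul_sub, sub_mul, mul_assoc]
    abel
  have h1 : k - e * k - k * e + e * k * e ≤ h - e * h - h * e + e * h * e := by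
    rw [← sub_nonneg]
    convert key (h - k) (sub_nonneg.mpr hkh) using 1
    simp only [mul_sub, sub_mul]
    abel
  have h2 : h - e * h - h * e + e * h * e = cfcₙ (fun r => r - f r * r - r * f r + f r * r * f r) h := by
    have e1 : cfcₙ (fun r => f r * r) h = e * h := by
      rw [cfcₙ_mul f (fun r => r) h (by fun_prop) hf0 (by fun_prop) rfl, cfcₙ_id' ℝ h]
    have e2 : cfcₙ (fun r => r * f r) h = h * e := by
      rw [cfcₙ_mul (fun r => r) f h (by fun_prop) rfl (by fun_prop) hf0, cfcₙ_id' ℝ h]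
    have e3 : cfcₙ (fun r => f r * r * f r) h = e * h * e := by
      rw [cfcₙ_mul (fun r => f r * r) f h (by fun_prop) (by simp) (by fun_prop) hf0, e1]
    rw [cfcₙ_add (fun r => r - f r * r - r * f r) (fun r => f r * r * f r) h (by fun_prop)
      (by simp) (by fun_prop) (by simp),
      cfcₙ_sub (fun r => r - f r * r) (fun r => r * f r) h (by fun_prop) (by simp) (by fun_prop)
      (by simp), cfcₙ_sub (fun r => r) (fun r => f r * r) h (by fun_prop) rfl (by fun_prop)
      (by simp), e1, e2, e3, cfcₙ_id' ℝ h]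
  refine (CStarAlgebra.norm_le_norm_of_nonneg_of_le (key k hk) h1).trans ?_
  rw [h2]
  refine norm_cfcₙ_le fun r hr => ?_
  have hr0 : 0 ≤ r := quasispectrum_nonneg_of_nonneg h hh r hr
  have e4 : r - f r * r - r * f r + f r * r * f r = r * (1 - f r) ^ 2 := by ring
  rw [e4, Real.norm_of_nonneg (by positivity)]
  rcases le_total δ r with hle | hle
  · have : f r = 1 := by
      rw [hf', max_eq_right hle]
      exact div_self (by have := hδ.trans_le hle; positivity)
    rw [this]
    simpa using hδ.le
  · have h3 : f r = r ^ 3 / δ ^ 3 := by rw [hf', max_eq_left hle]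
    have h4 : 0 ≤ f r := by rw [h3]; positivity
    have h5 : f r ≤ 1 := by
      rw [h3]
      exact div_le_one_of_le₀ (pow_le_pow_left₀ hr0 hle 3) (by positivity)
    have h6 : (1 - f r) ^ 2 ≤ 1 := by nlinarith
    nlinarith

namespace FellBundle

variable {G : Type u} [Group G] (A : FellBundle.{u, v} G)

/-- The inner product `(a, b) ↦ a* b` on the fiber `A_t`, with values in the unit fiber. -/
def inner (t : G) : A.fiber t →ₗ⋆[ℂ] A.fiber t →ₗ[ℂ] A.UnitFiber :=
  (A.mul (inv_mul_cancel t)).comp (A.invol rfl)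

/-- The left action of the unit fiber on the fiber `A_t`. -/
def act (t : G) : A.UnitFiber →ₗ[ℂ] A.fiber t →ₗ[ℂ] A.fiber t := A.mul (one_mul t)

theorem norm_inner_self (t : G) (a : A.fiber t) : ‖A.inner t a a‖ = ‖a‖ ^ 2 :=
  A.norm_invol_mul_self rfl (inv_mul_cancel t) a

theorem norm_inner_le (t : G) (a b : A.fiber t) : ‖A.inner t a b‖ ≤ ‖a‖ * ‖b‖ := by
  have := A.norm_mul_le' (inv_mul_cancel t) (A.invol rfl a) b
  rwa [A.norm_invol] at this

theorem act_mul (t : G) (a b : A.UnitFiber) (x : A.fiber t) :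
    A.act t (a * b) x = A.act t a (A.act t b x) := A.mul_assoc' _ _ _ _ _ _ _

theorem inner_act (t : G) (a : A.UnitFiber) (x y : A.fiber t) :
    A.inner t (A.act t a x) y = A.inner t x (A.act t (star a) y) :=
  (congrArg (fun z => A.mul (inv_mul_cancel t) z y)
    (A.invol_mul' (one_mul t) rfl inv_one rfl (mul_one _) a x)).trans (A.mul_assoc' _ _ _ _ _ _ _)

/-- The left inner product `(a, b) ↦ a b*` on the fiber `A_t`, with values in the unit fiber. -/
def outer (t : G) (a b : A.fiber t) : A.UnitFiber := A.mul (mul_inv_cancel t) a (A.invol rfl b)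

theorem outer_sub_left (t : G) (a b c : A.fiber t) :
    A.outer t (a - b) c = A.outer t a c - A.outer t b c :=
  LinearMap.map_sub₂ (A.mul (mul_inv_cancel t)) a b _

theorem outer_sub_right (t : G) (a b c : A.fiber t) :
    A.outer t a (b - c) = A.outer t a b - A.outer t a c :=
  (congrArg (A.mul (mul_inv_cancel t) a) (map_sub (A.invol rfl) b c)).trans (map_sub _ _ _)

theorem outer_act_left (t : G) (e : A.UnitFiber) (a b : A.fiber t) :
    A.outer t (A.act t e a) b = e * A.outer t a b := A.mul_assoc' _ _ _ _ _ _ _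

theorem outer_act_right (t : G) (e : A.UnitFiber) (a b : A.fiber t) :
    A.outer t a (A.act t e b) = A.outer t a b * star e :=
  (congrArg (A.mul (mul_inv_cancel t) a)
    (A.invol_mul' (one_mul t) rfl inv_one rfl (mul_one _) e b)).trans
    (A.mul_assoc' _ _ _ _ _ _ _).symm

theorem norm_outer_self (t : G) (a : A.fiber t) : ‖A.outer t a a‖ = ‖a‖ ^ 2 := by
  have h1 := A.norm_invol_mul_self (inv_inv t) (mul_inv_cancel t) (A.invol rfl a)
  rwa [A.norm_invol, A.invol_invol'] at h1

theorem exists_outer_self (t : G) (a : A.fiber t) :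
    ∃ c : A.UnitFiber, A.outer t a a = star c * c := by
  obtain ⟨c, hc⟩ := A.invol_mul_self_nonneg (inv_inv t) (mul_inv_cancel t) (A.invol rfl a)
  rw [A.invol_invol'] at hc
  exact ⟨c, hc⟩

theorem act_outer (t : G) (a b c : A.fiber t) :
    A.act t (A.outer t a b) c = A.mul (mul_one t) a (A.inner t b c) :=
  A.mul_assoc' _ _ _ _ _ _ _

theorem inner_mul_right (t : G) (a b : A.fiber t) (e : A.UnitFiber) :
    A.inner t a (A.mul (mul_one t) b e) = A.inner t a b * e :=
  (A.mul_assoc' _ _ _ _ _ _ _).symm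

theorem star_inner (t : G) (a b : A.fiber t) : star (A.inner t a b) = A.inner t b a :=
  (A.invol_mul' (inv_mul_cancel t) inv_one (inv_inv t) rfl (inv_mul_cancel t) _ b).trans
    (congrArg (A.mul (inv_mul_cancel t) (A.invol rfl b)) (A.invol_invol' rfl (inv_inv t) a))

theorem exists_local_unit_seq {ι : Type*} [Fintype ι] {t : G} (a : ι → A.fiber t) :
    ∃ g : ℕ → A.UnitFiber, (∀ n, star (g n) = g n) ∧ ∀ j, Filter.Tendsto
      (fun n => A.act t (g n * (∑ k, A.outer t (a k) (a k)) * g n) (a j))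
      Filter.atTop (nhds (a j)) := by
  let _ := CStarAlgebra.spectralOrder A.UnitFiber
  have _ := CStarAlgebra.spectralOrderedRing A.UnitFiber
  have hk : ∀ j, 0 ≤ A.outer t (a j) (a j) := fun j => by
    obtain ⟨c, hc⟩ := A.exists_outer_self t (a j)
    rw [hc]
    exact star_mul_self_nonneg c
  set h : A.UnitFiber := ∑ j, A.outer t (a j) (a j) with hdef
  have hh : 0 ≤ h := Finset.sum_nonneg fun j _ => hk j
  choose g hg hg' using fun n : ℕ => exists_local_unit h hh (1 / ((n : ℝ) + 1)) (by positivity)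
  refine ⟨g, hg, fun j => ?_⟩
  have hbound : ∀ n, ‖A.act t (g n * h * g n) (a j) - a j‖ ^ 2 ≤ 1 / ((n : ℝ) + 1) := fun n => by
    refine le_trans (le_of_eq ?_)
      (hg' n _ (hk j) (Finset.single_le_sum (fun i _ => hk i) (Finset.mem_univ j)))
    set e := g n * h * g n with he
    have hes : star e = e := by
      rw [he]
      simp only [star_mul, hg, mul_assoc]
      rw [(IsSelfAdjoint.of_nonneg hh).star_eq]
    rw [← A.norm_outer_self, A.outer_sub_left, A.outer_sub_right, A.outer_sub_right,
      A.outer_act_left, A.outer_act_left, A.outer_act_right, hes]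
    congr 1
    rw [← mul_assoc e]
    abel
  rw [tendsto_iff_norm_sub_tendsto_zero]
  have h0 := (tendsto_one_div_add_atTop_nhds_zero_nat (𝕜 := ℝ)).sqrt
  rw [Real.sqrt_zero] at h0
  exact squeeze_zero (fun n => norm_nonneg _) (fun n => Real.le_sqrt_of_sq_le (hbound n)) h0

/-- The matrix `(aᵢ* aⱼ)` is positive, in the form in which it is needed: a continuous linear
functional of matrices that is positive on the matrices `(sᵢ* sⱼ)` with entries `sᵢ` in the unit
fiber is positive on the matrices `(aᵢ* aⱼ)` with entries `aᵢ` in an arbitrary fiber. -/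
theorem sum_inner_nonneg {D : Type*} [NonUnitalCStarAlgebra D] [PartialOrder D]
    [StarOrderedRing D] {ι : Type*} [Fintype ι] (T : ι → ι → A.UnitFiber →ₗ[ℂ] D)
    (hc : ∀ i j, Continuous (T i j))
    (hT : ∀ s : ι → A.UnitFiber, 0 ≤ ∑ i, ∑ j, T i j (star (s i) * s j)) {t : G}
    (a : ι → A.fiber t) : 0 ≤ ∑ i, ∑ j, T i j (A.inner t (a i) (a j)) := by
  obtain ⟨g, hg, hlim⟩ := A.exists_local_unit_seq a
  have hin : ∀ i, Continuous (A.inner t (a i)) := fun i =>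
    (LinearMap.mkContinuous (A.inner t (a i)) ‖a i‖ (A.norm_inner_le t (a i))).continuous
  have hlim' : Filter.Tendsto (fun n => ∑ i, ∑ j, T i j (A.inner t (a i)
      (A.act t (g n * (∑ k, A.outer t (a k) (a k)) * g n) (a j)))) Filter.atTop
      (nhds (∑ i, ∑ j, T i j (A.inner t (a i) (a j)))) :=
    tendsto_finsetSum _ fun i _ => tendsto_finsetSum _ fun j _ =>
      ((hc i j).tendsto _).comp (((hin i).tendsto _).comp (hlim j))
  refine ge_of_tendsto' hlim' fun n => ?_
  have h1 : ∀ i j, A.inner t (a i) (A.act t (g n * (∑ k, A.outer t (a k) (a k)) * g n) (a j)) =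
      ∑ k, star (A.inner t (a k) (A.act t (g n) (a i))) *
        A.inner t (a k) (A.act t (g n) (a j)) := fun i j => by
    rw [A.act_mul, A.act_mul, ← hg n, ← A.inner_act, hg n, map_sum, LinearMap.sum_apply, map_sum]
    refine Finset.sum_congr rfl fun k _ => ?_
    rw [A.act_outer, A.inner_mul_right, A.star_inner]
  simp only [h1, map_sum]
  have h2 : ∑ i, ∑ j, ∑ k, T i j (star (A.inner t (a k) (A.act t (g n) (a i))) *
        A.inner t (a k) (A.act t (g n) (a j))) =
      ∑ k, ∑ i, ∑ j, T i j (star (A.inner t (a k) (A.act t (g n) (a i))) *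
        A.inner t (a k) (A.act t (g n) (a j))) :=
    (Finset.sum_congr rfl fun i _ => Finset.sum_comm).trans Finset.sum_comm
  rw [h2]
  exact Finset.sum_nonneg fun k _ => hT fun i => A.inner t (a k) (A.act t (g n) (a i))

end FellBundle

/-! ### Seminorms of positive semidefinite forms with values in a C*-algebra -/

section Form

variable {X D : Type*} [AddCommGroup X] [Module ℂ X] [NonUnitalCStarAlgebra D] [PartialOrder D]
  [StarOrderedRing D]

/-- A positive semidefinite form `I` on `X`, with values in the C*-algebra `D`, such that the
elements `I x y` act on `X` from the right. -/
structure IsPosForm (I : X →ₗ⋆[ℂ] X →ₗ[ℂ] D) : Prop where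
  nonneg : ∀ x, 0 ≤ I x x
  star_eq : ∀ x y, star (I x y) = I y x
  right : ∀ x y, ∃ z, ∀ u, I u z = I u x * I x y

variable {I : X →ₗ⋆[ℂ] X →ₗ[ℂ] D}

theorem IsPosForm.norm_sq_le (hI : IsPosForm I) (x y : X) :
    ‖I x y‖ ^ 2 ≤ ‖I x x‖ * ‖I y y‖ := by
  have key : ∀ c : ℝ, 0 < c → ‖I x x‖ ≤ c → ‖I x y‖ ^ 2 ≤ c * ‖I y y‖ := fun c hc hle => by
    obtain ⟨z, hz⟩ := hI.right x y
    set v := I x y with hv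
    have h1 : I y z = star v * v := by rw [hz, hI.star_eq]
    have h2 : I z y = star v * v := by rw [← hI.star_eq, h1, star_mul, star_star]
    have h3 : I z z = star v * I x x * v := by
      rw [hz, ← hI.star_eq x z, hz, star_mul, hI.star_eq x x]
    have h4 : I z z ≤ c • (star v * v) := by
      rw [h3]
      refine (CStarAlgebra.star_left_conjugate_le_norm_smul (hI.star_eq x x)).trans ?_
      exact smul_le_smul_of_nonneg_right hle (star_mul_self_nonneg v)
    have h5 : I (z - (c : ℂ) • y) (z - (c : ℂ) • y) =
        I z z - c • (star v * v) - c • (star v * v) + c • c • I y y := by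
      simp only [map_sub, map_smulₛₗ, LinearMap.sub_apply, LinearMap.smul_apply, h1, h2,
        Complex.conj_ofReal, RingHom.id_apply]
      simp only [Complex.coe_smul, smul_sub]
      abel
    have h6 : c • (star v * v) ≤ c • c • I y y := by
      have h7 := hI.nonneg (z - (c : ℂ) • y)
      rw [h5] at h7
      have h8 : 0 ≤ c • (star v * v) - c • (star v * v) - c • (star v * v) + c • c • I y y :=
        h7.trans (add_le_add_left (sub_le_sub_right (sub_le_sub_right h4 _) _) _)
      rw [sub_self, zero_sub, neg_add_eq_sub] at h8
      exact sub_nonneg.mp h8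
    have h9 := CStarAlgebra.norm_le_norm_of_nonneg_of_le
      (smul_nonneg hc.le (star_mul_self_nonneg v)) h6
    rw [norm_smul, norm_smul, norm_smul, CStarRing.norm_star_mul_self, Real.norm_of_nonneg hc.le,
      ← sq] at h9
    exact le_of_mul_le_mul_left h9 hc
  by_contra! hlt
  have hlim : Filter.Tendsto (fun c => c * ‖I y y‖) (nhdsWithin ‖I x x‖ (Set.Ioi ‖I x x‖))
      (nhds (‖I x x‖ * ‖I y y‖)) :=
    ((continuous_id.mul continuous_const).tendsto _).mono_left nhdsWithin_le_nhds
  have h := ge_of_tendsto hlim (b := ‖I x y‖ ^ 2) (Filter.eventually_of_mem self_mem_nhdsWithin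
    fun c hc => key c ((norm_nonneg _).trans_lt hc) (le_of_lt hc))
  exact absurd h (not_le.mpr hlt)

theorem IsPosForm.norm_le (hI : IsPosForm I) (x y : X) :
    ‖I x y‖ ≤ √‖I x x‖ * √‖I y y‖ := by
  rw [← Real.sqrt_mul (norm_nonneg _)]
  exact Real.le_sqrt_of_sq_le (hI.norm_sq_le x y)

/-- The seminorm `x ↦ ‖I x x‖ ^ (1 / 2)` of a positive semidefinite form. -/
def IsPosForm.seminorm (hI : IsPosForm I) : Seminorm ℂ X :=
  Seminorm.of (fun x => √‖I x x‖)
    (fun x y => by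
      refine Real.sqrt_le_iff.mpr ⟨by positivity, ?_⟩
      have h1 := hI.norm_le x y
      have h2 := hI.norm_le y x
      have h3 := Real.sq_sqrt (norm_nonneg (I x x))
      have h4 := Real.sq_sqrt (norm_nonneg (I y y))
      have h5 : ‖I (x + y) (x + y)‖ ≤ ‖I x x‖ + ‖I y x‖ + (‖I x y‖ + ‖I y y‖) := by
        simp only [map_add, LinearMap.add_apply]
        exact (norm_add_le _ _).trans (add_le_add (norm_add_le _ _) (norm_add_le _ _))
      nlinarith)
    (fun c x => by
      simp only [map_smulₛₗ, LinearMap.smul_apply, RingHom.id_apply, norm_smul, RCLike.norm_conj]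
      rw [← mul_assoc, Real.sqrt_mul (by positivity), Real.sqrt_mul_self (norm_nonneg c)])

theorem IsPosForm.seminorm_sq (hI : IsPosForm I) (x : X) : hI.seminorm x ^ 2 = ‖I x x‖ :=
  Real.sq_sqrt (norm_nonneg _)

theorem IsPosForm.norm_le' (hI : IsPosForm I) (x y : X) :
    ‖I x y‖ ≤ hI.seminorm x * hI.seminorm y := hI.norm_le x y

/-- A *-algebra that acts by bounded adjointable operators does so contractively with respect to
its greatest C*-seminorm. -/
theorem IsPosForm.action_le (hI : IsPosForm I) {S : Type*} [NonUnitalRing S] [StarRing S]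
    [Module ℂ S] [HasEnvelope S] (L : S →ₗ[ℂ] X →ₗ[ℂ] X)
    (hL : ∀ a b x, L (a * b) x = L a (L b x)) (hLI : ∀ a x y, I (L a x) y = I x (L (star a) y))
    (hb : ∀ a, ∃ C, ∀ x, hI.seminorm (L a x) ≤ C * hI.seminorm x) (a : S) (x : X) :
    hI.seminorm (L a x) ≤ (CStarSeminorm.greatest S).toSeminorm a * hI.seminorm x := by
  set N := hI.seminorm with hN
  have hd := Hull.denseRange_mk N
  have hb' : ∀ a, ∃ C, ∀ x, ‖(Hull.mk N).comp (L a) x‖ ≤ C * ‖Hull.mk N x‖ := fun a => by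
    simpa only [LinearMap.comp_apply, Hull.norm_mk] using hb a
  let E : S → (Hull N →L[ℂ] Hull N) := fun a => ((Hull.mk N).comp (L a)).extendOfNorm (Hull.mk N)
  have hE : ∀ a x, E a (Hull.mk N x) = Hull.mk N (L a x) := fun a x =>
    LinearMap.extendOfNorm_eq hd (hb' a) x
  have hext : ∀ f g : Hull N →L[ℂ] Hull N, (∀ x, f (Hull.mk N x) = g (Hull.mk N x)) → f = g :=
    fun f g h => ContinuousLinearMap.ext fun z =>
      Hull.ind (isClosed_eq f.continuous g.continuous) h z
  have hadd : ∀ a b, E (a + b) = E a + E b := fun a b => hext _ _ fun x => by simp [hE]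
  have hsmul : ∀ (c : ℂ) a, E (c • a) = c • E a := fun c a => hext _ _ fun x => by simp [hE]
  have hmul : ∀ a b, E (a * b) = (E a).comp (E b) := fun a b => hext _ _ fun x => by simp [hE, hL]
  have hle : ∀ a x, N (L a x) ≤ ‖E a‖ * N x := fun a x => by
    rw [← Hull.norm_mk N x, ← Hull.norm_mk N (L a x), ← hE]
    exact (E a).le_opNorm _
  have hmul_le : ∀ a b, ‖E (a * b)‖ ≤ ‖E a‖ * ‖E b‖ := fun a b => by
    rw [hmul]; exact ContinuousLinearMap.opNorm_comp_le _ _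
  have hsq : ∀ a, ‖E a‖ ^ 2 ≤ ‖E (star a * a)‖ := fun a => by
    have h1 : ‖E a‖ ≤ √‖E (star a * a)‖ := by
      refine ContinuousLinearMap.opNorm_le_bound _ (Real.sqrt_nonneg _) fun z => ?_
      refine Hull.ind (P := fun z => ‖E a z‖ ≤ √‖E (star a * a)‖ * ‖z‖)
        (isClosed_le (by fun_prop) (by fun_prop)) (fun x => ?_) z
      rw [hE, Hull.norm_mk, Hull.norm_mk]
      have h2 : N (L a x) ^ 2 ≤ ‖E (star a * a)‖ * N x ^ 2 := by
        rw [hI.seminorm_sq (L a x), hLI, ← hL]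
        have h3 := hI.norm_le' x (L (star a * a) x)
        have h4 := mul_le_mul_of_nonneg_left (hle (star a * a) x) (apply_nonneg N x)
        rw [← hN] at h3
        nlinarith
      refine le_of_sq_le_sq ?_ (by positivity)
      rw [mul_pow, Real.sq_sqrt (norm_nonneg _)]
      exact h2
    calc _ ≤ _ := pow_le_pow_left₀ (norm_nonneg _) h1 2
      _ = _ := Real.sq_sqrt (norm_nonneg _)
  have hstar : ∀ a, ‖E a‖ ≤ ‖E (star a)‖ := fun a => by
    have h1 := (hsq a).trans (hmul_le (star a) a)
    rcases (norm_nonneg (E a)).eq_or_lt with h0 | h0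
    · rw [← h0]; exact norm_nonneg _
    · exact le_of_mul_le_mul_right (by nlinarith) h0
  let q : CStarSeminorm S :=
    { toSeminorm := Seminorm.of (fun a => ‖E a‖) (fun a b => by rw [hadd]; exact norm_add_le _ _)
        (fun c a => by rw [hsmul]; exact norm_smul _ _)
      map_mul_le := hmul_le
      map_star_mul_self := fun a => le_antisymm
        ((hmul_le (star a) a).trans (by
          have h1 := hstar (star a)
          rw [star_star] at h1
          have h2 := mul_le_mul_of_nonneg_right h1 (norm_nonneg (E a))
          exact h2.trans (sq _).ge)) (hsq a) }
  exact (hle a x).trans (mul_le_mul_of_nonneg_right (q.le_greatest a) (apply_nonneg N x))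

end Form

/-! ### The maximal tensor product of Fell bundles -/

namespace FellBundle

variable {G : Type u} [Group G] {H : Type u'} [Group H]
  (A : FellBundle.{u, v} G) (B : FellBundle.{u', v'} H)

/-- The fibers `A_t ⊙ B_s` of the algebraic tensor product of two Fell bundles. -/
abbrev AlgFiber (p : G × H) : Type (max v v') := A.fiber p.1 ⊗[ℂ] B.fiber p.2

/-- The product `(a ⊙ b) (a' ⊙ b') = a a' ⊙ b b'` of the algebraic tensor product. -/
def algMul {p q r : G × H} (h : p * q = r) :
    AlgFiber A B p →ₗ[ℂ] AlgFiber A B q →ₗ[ℂ] AlgFiber A B r :=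
  TensorProduct.map₂ (A.mul (congrArg Prod.fst h)) (B.mul (congrArg Prod.snd h))

/-- The involution `(a ⊙ b)* = a* ⊙ b*` of the algebraic tensor product. -/
def algInvol {p r : G × H} (h : p⁻¹ = r) : AlgFiber A B p →ₗ⋆[ℂ] AlgFiber A B r :=
  TensorProduct.map (A.invol (congrArg Prod.fst h)) (B.invol (congrArg Prod.snd h))

theorem algMul_tmul {p q r : G × H} (h : p * q = r) (a : A.fiber p.1) (b : B.fiber p.2)
    (a' : A.fiber q.1) (b' : B.fiber q.2) : algMul A B h (a ⊗ₜ b) (a' ⊗ₜ b') =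
      A.mul (congrArg Prod.fst h) a a' ⊗ₜ B.mul (congrArg Prod.snd h) b b' :=
  rfl

theorem algInvol_tmul {p r : G × H} (h : p⁻¹ = r) (a : A.fiber p.1) (b : B.fiber p.2) :
    algInvol A B h (a ⊗ₜ b) =
      A.invol (congrArg Prod.fst h) a ⊗ₜ B.invol (congrArg Prod.snd h) b :=
  rfl

theorem algMul_assoc {t s r x y z : G × H} (h₁ : t * s = x) (h₂ : x * r = z) (h₃ : s * r = y)
    (h₄ : t * y = z) (a : AlgFiber A B t) (b : AlgFiber A B s) (c : AlgFiber A B r) :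
    algMul A B h₂ (algMul A B h₁ a b) c = algMul A B h₄ a (algMul A B h₃ b c) := by
  induction a using TensorProduct.induction_on with
  | zero => simp
  | add a a' ha ha' => simp only [map_add, LinearMap.add_apply, ha, ha']
  | tmul a a' =>
    induction b using TensorProduct.induction_on with
    | zero => simp
    | add a a' ha ha' => simp only [map_add, LinearMap.add_apply, ha, ha']
    | tmul b b' =>
      induction c using TensorProduct.induction_on with
      | zero => simp
      | add a a' ha ha' => simp only [map_add, ha, ha']
      | tmul c c' =>
        simp only [algMul_tmul]
        exact congrArg₂ (· ⊗ₜ[ℂ] ·) (A.mul_assoc' _ _ _ _ _ _ _) (B.mul_assoc' _ _ _ _ _ _ _)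

theorem algInvol_mul {t s r t' s' r' : G × H} (h : t * s = r) (hr : r⁻¹ = r') (ht : t⁻¹ = t')
    (hs : s⁻¹ = s') (h' : s' * t' = r') (a : AlgFiber A B t) (b : AlgFiber A B s) :
    algInvol A B hr (algMul A B h a b) = algMul A B h' (algInvol A B hs b) (algInvol A B ht a) := by
  induction a using TensorProduct.induction_on with
  | zero => simp
  | add a a' ha ha' => simp only [map_add, LinearMap.add_apply, ha, ha']
  | tmul a a' =>
    induction b using TensorProduct.induction_on with
    | zero => simp
    | add a a' ha ha' => simp only [map_add, LinearMap.add_apply, ha, ha']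
    | tmul b b' =>
      simp only [algMul_tmul, algInvol_tmul]
      exact congrArg₂ (· ⊗ₜ[ℂ] ·) (A.invol_mul' _ _ _ _ _ _ _) (B.invol_mul' _ _ _ _ _ _ _)

theorem algInvol_invol {t r : G × H} (h : t⁻¹ = r) (h' : r⁻¹ = t) (a : AlgFiber A B t) :
    algInvol A B h' (algInvol A B h a) = a := by
  induction a using TensorProduct.induction_on with
  | zero => simp
  | add a a' ha ha' => simp only [map_add, ha, ha']
  | tmul a a' =>
    simp only [algInvol_tmul]
    exact congrArg₂ (· ⊗ₜ[ℂ] ·) (A.invol_invol' _ _ _) (B.invol_invol' _ _ _)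

/-- The algebraic tensor product of the unit fibers, as a *-algebra. -/
abbrev AlgUnit : Type (max v v') := A.UnitFiber ⊗[ℂ] B.UnitFiber

/-! Shortcuts for instance search. -/

instance : NonUnitalRing (AlgUnit A B) := inferInstance
instance : AddCommGroup (AlgUnit A B) := inferInstance
instance : AddCommMonoid (AlgUnit A B) := inferInstance
instance : Module ℂ (AlgUnit A B) := inferInstance
instance : StarRing (AlgUnit A B) := inferInstance
instance : Mul (AlgUnit A B) := inferInstance

/-- The fiber of the algebraic tensor product at the unit of `G × H`, as a *-algebra. -/
def toAlgUnit : AlgFiber A B 1 ≃ₗ[ℂ] AlgUnit A B :=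
  LinearEquiv.refl ℂ (A.fiber 1 ⊗[ℂ] B.fiber 1)

/-- The maximal C*-norm on `A_e ⊙ B_e`. -/
def maxNormUnit : CStarSeminorm (AlgUnit A B) := CStarSeminorm.greatest (AlgUnit A B)

theorem toAlgUnit_mul (x y : AlgFiber A B 1) :
    toAlgUnit A B (algMul A B (mul_one 1) x y) = toAlgUnit A B x * toAlgUnit A B y := by
  induction x using TensorProduct.induction_on with
  | zero => simp
  | add a a' ha ha' => simp only [map_add, LinearMap.add_apply, ha, ha', add_mul]
  | tmul a a' =>
    induction y using TensorProduct.induction_on with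
    | zero => simp
    | add a a' ha ha' => simp only [map_add, ha, ha', mul_add]
    | tmul b b' =>
      exact (Algebra.TensorProduct.tmul_mul_tmul (R := ℂ) (A := A.UnitFiber) (B := B.UnitFiber)
        a b a' b').symm

theorem toAlgUnit_star (x : AlgFiber A B 1) :
    toAlgUnit A B (algInvol A B inv_one x) = star (toAlgUnit A B x) := by
  induction x using TensorProduct.induction_on with
  | zero => simp
  | add a a' ha ha' => simp only [map_add, ha, ha', star_add]
  | tmul a a' => rfl

/-- The form `(x, y) ↦ x* y` on `A_t ⊙ B_s`, with values in `A_e ⊙ B_e`. -/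
def algInner (p : G × H) : AlgFiber A B p →ₗ⋆[ℂ] AlgFiber A B p →ₗ[ℂ] AlgUnit A B :=
  TensorProduct.map₂ (A.inner p.1) (B.inner p.2)

/-- The left action of `A_e ⊙ B_e` on `A_t ⊙ B_s`. -/
def algAct (p : G × H) : AlgUnit A B →ₗ[ℂ] AlgFiber A B p →ₗ[ℂ] AlgFiber A B p :=
  TensorProduct.map₂ (A.act p.1) (B.act p.2)

theorem algInner_tmul (p : G × H) (a a' : A.fiber p.1) (b b' : B.fiber p.2) :
    algInner A B p (a ⊗ₜ b) (a' ⊗ₜ b') = A.inner p.1 a a' ⊗ₜ B.inner p.2 b b' :=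
  rfl

theorem algAct_tmul (p : G × H) (a : A.UnitFiber) (a' : A.fiber p.1) (b : B.UnitFiber)
    (b' : B.fiber p.2) :
    algAct A B p (a ⊗ₜ b) (a' ⊗ₜ b') = A.act p.1 a a' ⊗ₜ B.act p.2 b b' :=
  rfl

theorem algInner_eq {p r : G × H} (h : p⁻¹ = r) (h' : r * p = 1) (x y : AlgFiber A B p) :
    toAlgUnit A B (algMul A B h' (algInvol A B h x) y) = algInner A B p x y := by
  subst h
  induction x using TensorProduct.induction_on with
  | zero => simp
  | add a a' ha ha' => simp only [map_add, LinearMap.add_apply, ha, ha']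
  | tmul a a' =>
    induction y using TensorProduct.induction_on with
    | zero => simp
    | add a a' ha ha' => simp only [map_add, ha, ha']
    | tmul b b' => rfl

theorem algAct_eq (p : G × H) (w : AlgFiber A B 1) (x : AlgFiber A B p) :
    algAct A B p (toAlgUnit A B w) x = algMul A B (one_mul p) w x := by
  induction w using TensorProduct.induction_on with
  | zero => simp
  | add a a' ha ha' => simp only [map_add, LinearMap.add_apply, ha, ha']
  | tmul a a' =>
    induction x using TensorProduct.induction_on with
    | zero => simp
    | add a a' ha ha' => simp only [map_add, ha, ha']
    | tmul b b' => rfl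

theorem star_algInner (p : G × H) (x y : AlgFiber A B p) :
    star (algInner A B p x y) = algInner A B p y x := by
  have h' : p⁻¹ * p = 1 := inv_mul_cancel p
  rw [← algInner_eq A B rfl h', ← toAlgUnit_star,
    algInvol_mul A B h' inv_one (inv_inv p) rfl h', algInvol_invol, algInner_eq]

theorem algInner_mul_right (p : G × H) (u x : AlgFiber A B p) (w : AlgFiber A B 1) :
    algInner A B p u (algMul A B (mul_one p) x w) = algInner A B p u x * toAlgUnit A B w := by
  have h' : p⁻¹ * p = 1 := inv_mul_cancel p
  rw [← algInner_eq A B rfl h', ← algInner_eq A B rfl h', ← toAlgUnit_mul,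
    algMul_assoc A B h' (mul_one 1) (mul_one p) h']

theorem algAct_mul (p : G × H) (w w' : AlgUnit A B) (x : AlgFiber A B p) :
    algAct A B p (w * w') x = algAct A B p w (algAct A B p w' x) := by
  obtain ⟨w, rfl⟩ := (toAlgUnit A B).surjective w
  obtain ⟨w', rfl⟩ := (toAlgUnit A B).surjective w'
  rw [← toAlgUnit_mul, algAct_eq, algAct_eq, algAct_eq, algMul_assoc]

/-- `(x y)* (x' y') = y* (x* x') y'` -/
theorem algInner_algMul {p q r : G × H} (h : p * q = r) (x x' : AlgFiber A B p)
    (y y' : AlgFiber A B q) :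
    algInner A B r (algMul A B h x y) (algMul A B h x' y') =
      algInner A B q y (algAct A B q (algInner A B p x x') y') := by
  have h1 : r⁻¹ * r = 1 := inv_mul_cancel r
  have h2 : q⁻¹ * q = 1 := inv_mul_cancel q
  have h3 : p⁻¹ * p = 1 := inv_mul_cancel p
  have h4 : q⁻¹ * p⁻¹ = r⁻¹ := by rw [← h, mul_inv_rev]
  have h5 : p⁻¹ * r = q := by rw [← h, inv_mul_cancel_left]
  rw [← algInner_eq A B rfl h1, ← algInner_eq A B rfl h2, ← algInner_eq A B rfl h3, algAct_eq,
    algInvol_mul A B h rfl rfl rfl h4, algMul_assoc A B h4 h1 h5 h2,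
    algMul_assoc A B h3 (one_mul q) h h5]

theorem algInner_act (p : G × H) (w : AlgUnit A B) (x y : AlgFiber A B p) :
    algInner A B p (algAct A B p w x) y = algInner A B p x (algAct A B p (star w) y) := by
  obtain ⟨w, rfl⟩ := (toAlgUnit A B).surjective w
  have h : p⁻¹ * p = 1 := inv_mul_cancel p
  rw [← toAlgUnit_star, algAct_eq, algAct_eq, ← algInner_eq A B rfl h, ← algInner_eq A B rfl h,
    algInvol_mul A B (one_mul p) rfl inv_one rfl (mul_one _), algMul_assoc]

/-- The maximal tensor product `A_e ⊗_max B_e` of the unit fibers. -/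
abbrev MaxUnit : Type (max v v') := MaxTensorProduct A.UnitFiber B.UnitFiber

/-! Shortcuts for instance search. -/

instance : NonUnitalCStarAlgebra (MaxUnit A B) := inferInstance
instance : NonUnitalNormedRing (MaxUnit A B) := inferInstance
instance : NonUnitalRing (MaxUnit A B) := inferInstance
instance : NormedAddCommGroup (MaxUnit A B) := inferInstance
instance : SeminormedAddCommGroup (MaxUnit A B) := inferInstance
instance : AddCommGroup (MaxUnit A B) := inferInstance
instance : AddCommMonoid (MaxUnit A B) := inferInstance
instance : Norm (MaxUnit A B) := inferInstance
instance : TopologicalSpace (MaxUnit A B) := inferInstance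
instance : T2Space (MaxUnit A B) := inferInstance
instance : StarRing (MaxUnit A B) := inferInstance
instance : Star (MaxUnit A B) := inferInstance
instance : Mul (MaxUnit A B) := inferInstance
instance : Module ℂ (MaxUnit A B) := inferInstance

/-- The form `(x, y) ↦ x* y` on `A_t ⊙ B_s`, with values in `A_e ⊗_max B_e`. -/
def maxForm (p : G × H) : AlgFiber A B p →ₗ⋆[ℂ] AlgFiber A B p →ₗ[ℂ] MaxUnit A B :=
  (algInner A B p).compr₂ₛₗ (MaxTensorProduct.mk A.UnitFiber B.UnitFiber)

theorem maxForm_apply (p : G × H) (x y : AlgFiber A B p) :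
    maxForm A B p x y = MaxTensorProduct.mk A.UnitFiber B.UnitFiber (algInner A B p x y) := rfl

theorem maxForm_nonneg [PartialOrder (MaxUnit A B)] [StarOrderedRing (MaxUnit A B)] (p : G × H)
    (x : AlgFiber A B p) : 0 ≤ maxForm A B p x x := by
  set θ := MaxTensorProduct.mk A.UnitFiber B.UnitFiber with hθ
  have hbd : ∀ a b, ‖θ (a ⊗ₜ b)‖ ≤ ‖a‖ * ‖b‖ := fun a b => by
    rw [hθ, MaxTensorProduct.mk, CStarSeminorm.Completion.norm_mk]
    exact CStarSeminorm.map_tmul_le _ a b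
  obtain ⟨n, a, b, rfl⟩ : ∃ (n : ℕ) (a : Fin n → A.fiber p.1) (b : Fin n → B.fiber p.2),
      x = ∑ i, a i ⊗ₜ[ℂ] b i := by
    obtain ⟨s, rfl⟩ := TensorProduct.exists_finset x
    refine ⟨s.card, fun i => (s.equivFin.symm i).1.1, fun i => (s.equivFin.symm i).1.2, ?_⟩
    rw [← Finset.sum_coe_sort]
    exact (Equiv.sum_comp s.equivFin.symm (fun i => i.1.1 ⊗ₜ[ℂ] i.1.2)).symm
  have h1 : maxForm A B p (∑ i, a i ⊗ₜ[ℂ] b i) (∑ i, a i ⊗ₜ[ℂ] b i) =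
      ∑ i, ∑ j, θ (A.inner p.1 (a i) (a j) ⊗ₜ B.inner p.2 (b i) (b j)) := by
    simp only [map_sum, LinearMap.sum_apply, maxForm_apply, algInner_tmul]
    exact Finset.sum_comm
  rw [h1]
  refine A.sum_inner_nonneg (fun i j => θ ∘ₗ
    (TensorProduct.mk ℂ A.UnitFiber B.UnitFiber).flip (B.inner p.2 (b i) (b j)))
    (fun i j => ?_) (fun s => ?_) a
  · exact (LinearMap.mkContinuous _ ‖B.inner p.2 (b i) (b j)‖ fun s => by
      rw [mul_comm]; exact hbd _ _).continuous
  refine B.sum_inner_nonneg (fun i j => θ ∘ₗ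
    (TensorProduct.mk ℂ A.UnitFiber B.UnitFiber) (star (s i) * s j))
    (fun i j => ?_) (fun r => ?_) b
  · exact (LinearMap.mkContinuous _ ‖star (s i) * s j‖ fun s => hbd _ _).continuous
  have h2 : ∑ i, ∑ j, θ ((star (s i) * s j) ⊗ₜ (star (r i) * r j)) =
      star (θ (∑ i, s i ⊗ₜ r i)) * θ (∑ i, s i ⊗ₜ r i) := by
    rw [hθ, MaxTensorProduct.mk, ← CStarSeminorm.Completion.mk_star,
      ← CStarSeminorm.Completion.mk_mul]
    simp only [← map_sum]
    congr 1
    simp only [star_sum, Finset.sum_mul_sum, TensorProduct.star_tmul,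
      Algebra.TensorProduct.tmul_mul_tmul]
  exact h2 ▸ star_mul_self_nonneg _

theorem isPosForm_maxForm [PartialOrder (MaxUnit A B)] [StarOrderedRing (MaxUnit A B)]
    (p : G × H) : IsPosForm (maxForm A B p) where
  nonneg := maxForm_nonneg A B p
  star_eq x y := by
    rw [maxForm_apply, maxForm_apply, MaxTensorProduct.mk, ← CStarSeminorm.Completion.mk_star,
      star_algInner]
  right x y := by
    refine ⟨algMul A B (mul_one p) x ((toAlgUnit A B).symm (algInner A B p x y)), fun u => ?_⟩
    rw [maxForm_apply, maxForm_apply, maxForm_apply, algInner_mul_right,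
      LinearEquiv.apply_symm_apply, MaxTensorProduct.mk, CStarSeminorm.Completion.mk_mul]

/-- The maximal norm on `A_t ⊙ B_s`: the norm of `x` is the square root of the maximal C*-norm of
the element `x* x` of `A_e ⊙ B_e`. -/
def maxNorm (p : G × H) : Seminorm ℂ (AlgFiber A B p) :=
  Seminorm.of (fun x => √((maxNormUnit A B).toSeminorm
      (toAlgUnit A B (algMul A B (inv_mul_cancel p) (algInvol A B rfl x) x))))
    (fun x y => by
      let _ := CStarAlgebra.spectralOrder (MaxUnit A B)
      have _ := CStarAlgebra.spectralOrderedRing (MaxUnit A B)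
      simp only [algInner_eq, maxNormUnit, ← CStarSeminorm.Completion.norm_mk]
      exact map_add_le_add (isPosForm_maxForm A B p).seminorm x y)
    (fun c x => by
      let _ := CStarAlgebra.spectralOrder (MaxUnit A B)
      have _ := CStarAlgebra.spectralOrderedRing (MaxUnit A B)
      simp only [algInner_eq, maxNormUnit, ← CStarSeminorm.Completion.norm_mk]
      exact map_smul_eq_mul (isPosForm_maxForm A B p).seminorm c x)

end FellBundle

namespace FellBundle

variable {G : Type u} [Group G] {H : Type u'} [Group H]
  (A : FellBundle.{u, v} G) (B : FellBundle.{u', v'} H)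

theorem maxNorm_eq [PartialOrder (MaxUnit A B)] [StarOrderedRing (MaxUnit A B)] (p : G × H)
    (x : AlgFiber A B p) : maxNorm A B p x = (isPosForm_maxForm A B p).seminorm x := by
  change √((maxNormUnit A B).toSeminorm (toAlgUnit A B
    (algMul A B (inv_mul_cancel p) (algInvol A B rfl x) x))) = √‖maxForm A B p x x‖
  rw [algInner_eq, maxForm_apply, MaxTensorProduct.mk, CStarSeminorm.Completion.norm_mk]
  rfl

theorem maxNorm_sq (p : G × H) (x : AlgFiber A B p) :
    maxNorm A B p x ^ 2 = ‖maxForm A B p x x‖ := by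
  let _ := CStarAlgebra.spectralOrder (MaxUnit A B)
  have _ := CStarAlgebra.spectralOrderedRing (MaxUnit A B)
  rw [maxNorm_eq, IsPosForm.seminorm_sq]

theorem norm_maxForm_le (p : G × H) (x y : AlgFiber A B p) :
    ‖maxForm A B p x y‖ ≤ maxNorm A B p x * maxNorm A B p y := by
  let _ := CStarAlgebra.spectralOrder (MaxUnit A B)
  have _ := CStarAlgebra.spectralOrderedRing (MaxUnit A B)
  rw [maxNorm_eq, maxNorm_eq]
  exact IsPosForm.norm_le' _ x y

theorem maxNorm_act_le (p : G × H) {C : Type*} [NonUnitalCStarAlgebra C]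
    (L : C →ₗ[ℂ] AlgFiber A B p →ₗ[ℂ] AlgFiber A B p) (hL : ∀ a b x, L (a * b) x = L a (L b x))
    (hI : ∀ a x y, algInner A B p (L a x) y = algInner A B p x (L (star a) y)) (c : C)
    (x : AlgFiber A B p) : maxNorm A B p (L c x) ≤ ‖c‖ * maxNorm A B p x := by
  let _ := CStarAlgebra.spectralOrder (MaxUnit A B)
  have _ := CStarAlgebra.spectralOrderedRing (MaxUnit A B)
  have h := action_bound L hL (maxForm A B p)
    (fun a x y => congrArg (MaxTensorProduct.mk A.UnitFiber B.UnitFiber) (hI a x y))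
    (maxForm_nonneg A B p) c x
  rw [← maxNorm_sq, ← maxNorm_sq, ← mul_pow] at h
  exact le_of_sq_le_sq h (mul_nonneg (norm_nonneg _) (apply_nonneg _ _))

theorem maxNorm_algAct_tmul_le (p : G × H) (a : A.UnitFiber) (b : B.UnitFiber)
    (x : AlgFiber A B p) :
    maxNorm A B p (algAct A B p (a ⊗ₜ b) x) ≤ ‖a‖ * (‖b‖ * maxNorm A B p x) := by
  have h1 : ∀ x, algAct A B p (a ⊗ₜ b) x = TensorProduct.map (A.act p.1 a) LinearMap.id
      (TensorProduct.map LinearMap.id (B.act p.2 b) x) := fun x => by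
    induction x using TensorProduct.induction_on with
    | zero => simp
    | tmul x y => rfl
    | add x y hx hy => simp only [map_add, hx, hy]
  rw [h1]
  refine (maxNorm_act_le A B p ((TensorProduct.mapBilinear (RingHom.id ℂ) (A.fiber p.1)
    (B.fiber p.2) (A.fiber p.1) (B.fiber p.2)).flip LinearMap.id ∘ₗ A.act p.1)
    (fun a b x => ?_) (fun a x y => ?_) a _).trans
    (mul_le_mul_of_nonneg_left (maxNorm_act_le A B p ((TensorProduct.mapBilinear (RingHom.id ℂ)
    (A.fiber p.1) (B.fiber p.2) (A.fiber p.1) (B.fiber p.2)) LinearMap.id ∘ₗ B.act p.2)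
    (fun a b x => ?_) (fun a x y => ?_) b x) (norm_nonneg a))
  · induction x using TensorProduct.induction_on with
    | zero => simp
    | tmul x y => simp [A.act_mul]
    | add x y hx hy => simp only [map_add, hx, hy]
  · induction x using TensorProduct.induction_on with
    | zero => simp
    | add x y hx hy => simp only [map_add, LinearMap.add_apply, hx, hy]
    | tmul x x' =>
      induction y using TensorProduct.induction_on with
      | zero => simp
      | add x y hx hy => simp only [map_add, hx, hy]
      | tmul y y' => simp [algInner_tmul, A.inner_act]
  · induction x using TensorProduct.induction_on with
    | zero => simp
    | tmul x y => simp [B.act_mul]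
    | add x y hx hy => simp only [map_add, hx, hy]
  · induction x using TensorProduct.induction_on with
    | zero => simp
    | add x y hx hy => simp only [map_add, LinearMap.add_apply, hx, hy]
    | tmul x x' =>
      induction y using TensorProduct.induction_on with
      | zero => simp
      | add x y hx hy => simp only [map_add, hx, hy]
      | tmul y y' => simp [algInner_tmul, B.inner_act]

theorem maxNorm_algAct_le (p : G × H) (w : AlgUnit A B) (x : AlgFiber A B p) :
    maxNorm A B p (algAct A B p w x) ≤ (maxNormUnit A B).toSeminorm w * maxNorm A B p x := by
  let _ := CStarAlgebra.spectralOrder (MaxUnit A B)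
  have _ := CStarAlgebra.spectralOrderedRing (MaxUnit A B)
  rw [maxNorm_eq, maxNorm_eq]
  refine (isPosForm_maxForm A B p).action_le (algAct A B p) (algAct_mul A B p)
    (fun a x y => congrArg (MaxTensorProduct.mk A.UnitFiber B.UnitFiber)
      (algInner_act A B p a x y)) (fun w => ?_) w x
  simp only [← maxNorm_eq]
  induction w using TensorProduct.induction_on with
  | zero => exact ⟨0, fun x => by simp⟩
  | tmul a b => exact ⟨‖a‖ * ‖b‖, fun x => by
      rw [mul_assoc]; exact maxNorm_algAct_tmul_le A B p a b x⟩
  | add w w' h h' =>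
    obtain ⟨c, hc⟩ := h
    obtain ⟨d, hd⟩ := h'
    refine ⟨c + d, fun x => ?_⟩
    rw [map_add, LinearMap.add_apply, add_mul]
    exact (map_add_le_add _ _ _).trans (add_le_add (hc x) (hd x))

theorem maxNormUnit_algInner (p : G × H) (x : AlgFiber A B p) :
    (maxNormUnit A B).toSeminorm (algInner A B p x x) = maxNorm A B p x ^ 2 := by
  rw [maxNorm_sq, maxForm_apply, MaxTensorProduct.mk, CStarSeminorm.Completion.norm_mk]
  rfl

theorem maxNorm_algMul_le {p q r : G × H} (h : p * q = r) (x : AlgFiber A B p)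
    (y : AlgFiber A B q) :
    maxNorm A B r (algMul A B h x y) ≤ maxNorm A B p x * maxNorm A B q y := by
  have h1 : maxForm A B r (algMul A B h x y) (algMul A B h x y) =
      maxForm A B q y (algAct A B q (algInner A B p x x) y) :=
    congrArg (MaxTensorProduct.mk A.UnitFiber B.UnitFiber) (algInner_algMul A B h x x y y)
  refine le_of_sq_le_sq ?_ (mul_nonneg (apply_nonneg _ _) (apply_nonneg _ _))
  rw [maxNorm_sq, h1]
  refine (norm_maxForm_le A B q _ _).trans ((mul_le_mul_of_nonneg_left
    (maxNorm_algAct_le A B q _ y) (apply_nonneg _ _)).trans (le_of_eq ?_))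
  rw [maxNormUnit_algInner]
  ring

theorem maxNorm_one (w : AlgFiber A B 1) :
    maxNorm A B 1 w = (maxNormUnit A B).toSeminorm (toAlgUnit A B w) := by
  have h : algInner A B 1 w w = star (toAlgUnit A B w) * toAlgUnit A B w := by
    rw [← algInner_eq A B inv_one (mul_one 1), toAlgUnit_mul, toAlgUnit_star]
  have h2 := maxNormUnit_algInner A B 1 w
  rw [h, (maxNormUnit A B).map_star_mul_self] at h2
  exact ((sq_eq_sq₀ (apply_nonneg _ _) (apply_nonneg _ _)).mp h2).symm

theorem maxNorm_algInvol_mul_self {p r : G × H} (h : p⁻¹ = r) (h' : r * p = 1)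
    (x : AlgFiber A B p) :
    maxNorm A B 1 (algMul A B h' (algInvol A B h x) x) = maxNorm A B p x ^ 2 := by
  rw [maxNorm_one, algInner_eq, maxNormUnit_algInner]

theorem maxNorm_algInvol_le {p r : G × H} (h : p⁻¹ = r) (x : AlgFiber A B p) :
    maxNorm A B r (algInvol A B h x) ≤ maxNorm A B p x := by
  have e : r⁻¹ = p := by rw [← h, inv_inv]
  have h1 : p * r = 1 := by rw [← h, mul_inv_cancel]
  have h2 := maxNorm_algInvol_mul_self A B e h1 (algInvol A B h x)
  have h3 := maxNorm_algMul_le A B h1 x (algInvol A B h x)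
  rw [algInvol_invol] at h2
  rw [h2] at h3
  rcases (apply_nonneg (maxNorm A B r) (algInvol A B h x)).eq_or_lt with h0 | h0
  · rw [← h0]; exact apply_nonneg _ _
  · exact le_of_mul_le_mul_right (by nlinarith) h0

/-- The fiber `A_t ⊗_max B_s`. -/
abbrev MaxFiber (p : G × H) : Type (max v v') := Hull (maxNorm A B p)

/-- The extended product. -/
def maxMul {p q r : G × H} (h : p * q = r) :
    MaxFiber A B p →L[ℂ] MaxFiber A B q →L[ℂ] MaxFiber A B r :=
  Hull.extend₂ (algMul A B h) (maxNorm_algMul_le A B h)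

/-- The extended involution. -/
def maxInvol {p r : G × H} (h : p⁻¹ = r) : MaxFiber A B p →L⋆[ℂ] MaxFiber A B r :=
  Hull.extendStar (algInvol A B h)

theorem maxMul_mk {p q r : G × H} (h : p * q = r) (x : AlgFiber A B p) (y : AlgFiber A B q) :
    maxMul A B h (Hull.mk _ x) (Hull.mk _ y) = Hull.mk _ (algMul A B h x y) :=
  Hull.extend₂_mk _ _ x y

theorem maxInvol_mk {p r : G × H} (h : p⁻¹ = r) (x : AlgFiber A B p) :
    maxInvol A B h (Hull.mk _ x) = Hull.mk _ (algInvol A B h x) :=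
  Hull.extendStar_mk _ (maxNorm_algInvol_le A B h) x

/-- The unit fiber of the maximal tensor product is the maximal tensor product of the unit
fibers. -/
def maxUnitEquiv : MaxFiber A B 1 →L[ℂ] MaxUnit A B :=
  ((MaxTensorProduct.mk A.UnitFiber B.UnitFiber).comp
    (toAlgUnit A B).toLinearMap).extendOfNorm (Hull.mk _)

theorem norm_mk_toAlgUnit (x : AlgFiber A B 1) :
    ‖MaxTensorProduct.mk A.UnitFiber B.UnitFiber (toAlgUnit A B x)‖ = ‖Hull.mk (maxNorm A B 1) x‖ := by
  rw [Hull.norm_mk, maxNorm_one, MaxTensorProduct.mk, CStarSeminorm.Completion.norm_mk]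
  rfl

theorem maxUnitEquiv_mk (x : AlgFiber A B 1) : maxUnitEquiv A B (Hull.mk _ x) =
    MaxTensorProduct.mk A.UnitFiber B.UnitFiber (toAlgUnit A B x) :=
  LinearMap.extendOfNorm_eq (Hull.denseRange_mk _) ⟨1, fun x => by
    rw [one_mul]; exact (norm_mk_toAlgUnit A B x).le⟩ x

theorem norm_maxUnitEquiv (x : MaxFiber A B 1) : ‖maxUnitEquiv A B x‖ = ‖x‖ := by
  refine Hull.ind (P := fun x => ‖maxUnitEquiv A B x‖ = ‖x‖)
    (isClosed_eq (by fun_prop) (by fun_prop)) (fun x => ?_) x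
  rw [maxUnitEquiv_mk, norm_mk_toAlgUnit]

theorem maxUnitEquiv_injective : Function.Injective (maxUnitEquiv A B) :=
  (AddMonoidHomClass.isometry_of_norm (maxUnitEquiv A B) (norm_maxUnitEquiv A B)).injective

theorem maxUnitEquiv_surjective : Function.Surjective (maxUnitEquiv A B) := by
  have hi := AddMonoidHomClass.isometry_of_norm (maxUnitEquiv A B) (norm_maxUnitEquiv A B)
  have hd : DenseRange (maxUnitEquiv A B) := by
    refine (CStarSeminorm.Completion.denseRange_mk _).mono ?_
    rintro _ ⟨x, rfl⟩
    exact ⟨Hull.mk _ ((toAlgUnit A B).symm x), by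
      rw [maxUnitEquiv_mk, LinearEquiv.apply_symm_apply]; rfl⟩
  rw [← Set.range_eq_univ, ← hd.closure_range]
  exact hi.isClosedEmbedding.isClosed_range.closure_eq.symm

theorem maxUnitEquiv_mul_star (x : MaxFiber A B 1) :
    maxUnitEquiv A B (maxMul A B (mul_one 1) (maxInvol A B inv_one x) x) =
      star (maxUnitEquiv A B x) * maxUnitEquiv A B x := by
  refine Hull.ind (P := fun x => maxUnitEquiv A B (maxMul A B (mul_one 1)
      (maxInvol A B inv_one x) x) = star (maxUnitEquiv A B x) * maxUnitEquiv A B x)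
    (isClosed_eq (by fun_prop)
      ((CStarSeminorm.Completion.continuous_mul' _).comp₂
        ((CStarSeminorm.Completion.continuous_star' _).comp (maxUnitEquiv A B).continuous)
        (maxUnitEquiv A B).continuous)) (fun x => ?_) x
  rw [maxInvol_mk, maxMul_mk, maxUnitEquiv_mk, maxUnitEquiv_mk, toAlgUnit_mul, toAlgUnit_star,
    MaxTensorProduct.mk, CStarSeminorm.Completion.mk_mul, CStarSeminorm.Completion.mk_star]

theorem maxUnitEquiv_nonneg [PartialOrder (MaxUnit A B)] [StarOrderedRing (MaxUnit A B)]
    {p r : G × H} (h : p⁻¹ = r) (h' : r * p = 1) (x : MaxFiber A B p) :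
    0 ≤ maxUnitEquiv A B (maxMul A B h' (maxInvol A B h x) x) := by
  refine Hull.ind (P := fun x => 0 ≤ maxUnitEquiv A B (maxMul A B h' (maxInvol A B h x) x))
    ?_ (fun x => ?_) x
  · exact (CStarAlgebra.isClosed_nonneg (A := MaxUnit A B)).preimage
      (f := fun x => maxUnitEquiv A B (maxMul A B h' (maxInvol A B h x) x)) (by fun_prop)
  rw [maxInvol_mk, maxMul_mk, maxUnitEquiv_mk, algInner_eq]
  exact maxForm_nonneg A B p x

/-- The maximal tensor product of two Fell bundles: the bundle over `G × H` with fibers the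
completions of `A_t ⊙ B_s` in the norm `‖x‖ = ‖x* x‖_max ^ (1 / 2)`, with the product and
the involution that extend those of the algebraic tensor product. -/
def maxTensor : FellBundle.{max u u', max v v'} (G × H) where
  fiber p := MaxFiber A B p
  mul h := (ContinuousLinearMap.coeLM ℂ).comp (maxMul A B h).toLinearMap
  invol h := (maxInvol A B h).toLinearMap
  mul_assoc' {t s r x y z} h₁ h₂ h₃ h₄ a b c := by
    change maxMul A B h₂ (maxMul A B h₁ a b) c = maxMul A B h₄ a (maxMul A B h₃ b c)
    refine Hull.ind₂ (P := fun a b => maxMul A B h₂ (maxMul A B h₁ a b) c =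
      maxMul A B h₄ a (maxMul A B h₃ b c)) (isClosed_eq (by fun_prop) (by fun_prop))
      (fun a b => ?_) a b
    refine Hull.ind (P := fun c => maxMul A B h₂ (maxMul A B h₁ (Hull.mk _ a) (Hull.mk _ b)) c =
      maxMul A B h₄ (Hull.mk _ a) (maxMul A B h₃ (Hull.mk _ b) c))
      (isClosed_eq (by fun_prop) (by fun_prop)) (fun c => ?_) c
    simp only [maxMul_mk, algMul_assoc A B h₁ h₂ h₃ h₄]
  invol_mul' {t s r t' s' r'} h hr ht hs h' a b := by
    change maxInvol A B hr (maxMul A B h a b) =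
      maxMul A B h' (maxInvol A B hs b) (maxInvol A B ht a)
    refine Hull.ind₂ (P := fun a b => maxInvol A B hr (maxMul A B h a b) =
      maxMul A B h' (maxInvol A B hs b) (maxInvol A B ht a))
      (isClosed_eq (by fun_prop) (by fun_prop)) (fun a b => ?_) a b
    simp only [maxMul_mk, maxInvol_mk, algInvol_mul A B h hr ht hs h']
  invol_invol' {t r} h h' a := by
    change maxInvol A B h' (maxInvol A B h a) = a
    refine Hull.ind (P := fun a => maxInvol A B h' (maxInvol A B h a) = a)
      (isClosed_eq (by fun_prop) (by fun_prop)) (fun a => ?_) a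
    simp only [maxInvol_mk, algInvol_invol]
  norm_mul_le' {t s r} h a b := by
    change ‖maxMul A B h a b‖ ≤ ‖a‖ * ‖b‖
    refine Hull.ind₂ (P := fun a b => ‖maxMul A B h a b‖ ≤ ‖a‖ * ‖b‖)
      (isClosed_le (by fun_prop) (by fun_prop)) (fun a b => ?_) a b
    rw [maxMul_mk, Hull.norm_mk, Hull.norm_mk, Hull.norm_mk]
    exact maxNorm_algMul_le A B h a b
  norm_invol_mul_self {t r} h h' a := by
    change ‖maxMul A B h' (maxInvol A B h a) a‖ = ‖a‖ ^ 2
    refine Hull.ind (P := fun a => ‖maxMul A B h' (maxInvol A B h a) a‖ = ‖a‖ ^ 2)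
      (isClosed_eq (by fun_prop) (by fun_prop)) (fun a => ?_) a
    rw [maxInvol_mk, maxMul_mk, Hull.norm_mk, Hull.norm_mk, maxNorm_algInvol_mul_self]
  invol_mul_self_nonneg {t r} h h' a := by
    change ∃ c : MaxFiber A B 1, maxMul A B h' (maxInvol A B h a) a =
      maxMul A B (mul_one 1) (maxInvol A B inv_one c) c
    let _ := CStarAlgebra.spectralOrder (MaxUnit A B)
    have _ := CStarAlgebra.spectralOrderedRing (MaxUnit A B)
    obtain ⟨d, hd⟩ := CStarAlgebra.nonneg_iff_eq_star_mul_self.mp (maxUnitEquiv_nonneg A B h h' a)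
    obtain ⟨c, rfl⟩ := maxUnitEquiv_surjective A B d
    exact ⟨c, maxUnitEquiv_injective A B (hd.trans (maxUnitEquiv_mul_star A B c).symm)⟩

/-- The canonical map of `A_t ⊙ B_s` to the fiber `A_t ⊗_max B_s`. -/
def maxTensorMk (t : G) (s : H) :
    A.fiber t ⊗[ℂ] B.fiber s →ₗ[ℂ] (maxTensor A B).fiber (t, s) :=
  Hull.mk (maxNorm A B (t, s))

end FellBundle

end

noncomputable section

/-! ### Homomorphisms of *-algebras into C*-algebras -/

section Envelope

variable {S : Type*} [NonUnitalRing S] [StarRing S] [Module ℂ S] [IsScalarTower ℂ S S]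
  [SMulCommClass ℂ S S] [StarModule ℂ S] {D : Type*} [NonUnitalCStarAlgebra D]

/-! Both algebras are enveloping C*-algebras that are generated by the elementary tensors of the
fibers. Each universal property yields a *-homomorphism with the prescribed values on these
generators, and the two homomorphisms are mutually inverse because they are so on generators.

From `C*(A ⊗_max B)` to `C*(A) ⊗_max C*(B)`: the algebraic fiber `A_t ⊙ B_s` has an evident image in
the target, and the point is to bound it by the norm of the fiber (`norm_algToFull_le`). By the
C*-identity it suffices to bound the image of `x* x`, which lies in `A_e ⊙ B_e`. There the map is a
*-homomorphism into a C*-algebra, hence dominated by the maximal C*-norm. So the map passes to the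
completed fibers, is a representation of the bundle, and induces `tensorToFull`.

From `C*(A) ⊗_max C*(B)` to `C*(A ⊗_max B)`: sections of `A` and of `B` multiply to sections of the
tensor product bundle. This bilinear map is multiplicative and preserves the involution, but it must
be shown to be bounded by the product of the two greatest C*-seminorms. That is the heart of the
matter, `seminorm_tmul_le`: every C*-seminorm `p` on the algebraic tensor product of the section
algebras satisfies `p (a ⊗ b) ≤ ‖a‖ ‖b‖`. The element `a ⊗ 1` need not exist, but left
multiplication by it does, and it is adjointable for the form `(x, y) ↦ x* y`. The unit fiber is a
C*-algebra, so it acts contractively; an element of any other fiber acts boundedly because `a* a`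
lies in the unit fiber; finite sums of such operators are bounded too. Hence the operator norm is a
C*-seminorm on the sections of `A`, at most the greatest one (`action_le`). The same applies to `B`,
and `p (a ⊗ b)² = p (a* a ⊗ b* b) ≤ ‖a‖ ‖b‖ p (a ⊗ b)`.

Uniqueness is automatic: *-homomorphisms of C*-algebras are contractive, and elementary tensors span
a dense subspace (`maxTensor_hom_ext`). -/

/-- The C*-seminorm `x ↦ p (φ x)`. -/
def CStarSeminorm.comp {T : Type*} [NonUnitalRing T] [StarRing T] [Module ℂ T]
    (p : CStarSeminorm T) (φ : S →⋆ₙₐ[ℂ] T) : CStarSeminorm S where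
  toSeminorm := p.toSeminorm.comp
    ({ toFun := φ
       map_add' := map_add φ
       map_smul' := map_smul φ } : S →ₗ[ℂ] T)
  map_mul_le x y := by
    change p.toSeminorm (φ (x * y)) ≤ p.toSeminorm (φ x) * p.toSeminorm (φ y)
    rw [map_mul]
    exact p.map_mul_le _ _
  map_star_mul_self x := by
    change p.toSeminorm (φ (star x * x)) = p.toSeminorm (φ x) ^ 2
    rw [map_mul, StarHomClass.map_star]
    exact p.map_star_mul_self _

/-- The norm of a C*-algebra, as a C*-seminorm. -/
def CStarSeminorm.ofNorm (D : Type*) [NonUnitalCStarAlgebra D] : CStarSeminorm D where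
  toSeminorm := normSeminorm ℂ D
  map_mul_le := norm_mul_le
  map_star_mul_self x := by
    change ‖star x * x‖ = ‖x‖ ^ 2
    rw [CStarRing.norm_star_mul_self, sq]

variable [HasEnvelope S]

/-- The C*-norm of the target pulls back to a C*-seminorm, so it is one of the seminorms whose
supremum is the greatest one. All extensions to enveloping algebras rest on this bound. -/
theorem norm_le_greatest (φ : S →⋆ₙₐ[ℂ] D) (x : S) :
    ‖φ x‖ ≤ (CStarSeminorm.greatest S).toSeminorm x :=
  ((CStarSeminorm.ofNorm D).comp φ).le_greatest x

/-- The canonical map of a *-algebra to its enveloping C*-algebra. -/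
def Envelope.mk (S : Type*) [NonUnitalRing S] [StarRing S] [Module ℂ S] [IsScalarTower ℂ S S]
    [SMulCommClass ℂ S S] [StarModule ℂ S] [HasEnvelope S] : S →⋆ₙₐ[ℂ] Envelope S where
  toFun := CStarSeminorm.Completion.mk (CStarSeminorm.greatest S)
  map_smul' := map_smul _
  map_zero' := map_zero _
  map_add' := map_add _
  map_mul' := CStarSeminorm.Completion.mk_mul _
  map_star' := CStarSeminorm.Completion.mk_star _

theorem Envelope.denseRange_mk : DenseRange (Envelope.mk S) :=
  CStarSeminorm.Completion.denseRange_mk _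

/-- The continuous linear extension of a *-homomorphism to the enveloping C*-algebra. -/
def Envelope.liftL (φ : S →⋆ₙₐ[ℂ] D) : Envelope S →L[ℂ] D :=
  LinearMap.extendOfNorm { toFun := φ, map_add' := map_add φ, map_smul' := map_smul φ }
    (CStarSeminorm.Completion.mk (CStarSeminorm.greatest S))

/-- `extendOfNorm` is an extension only when the map is bounded relative to the dense embedding;
`norm_le_greatest` supplies the constant `1`. -/
theorem Envelope.liftL_mk (φ : S →⋆ₙₐ[ℂ] D) (x : S) :
    Envelope.liftL φ (Envelope.mk S x) = φ x :=
  LinearMap.extendOfNorm_eq (CStarSeminorm.Completion.denseRange_mk _) ⟨1, fun x => by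
    rw [one_mul, CStarSeminorm.Completion.norm_mk]
    exact norm_le_greatest φ x⟩ x

/-- The universal property of the enveloping C*-algebra. -/
def Envelope.lift (φ : S →⋆ₙₐ[ℂ] D) : Envelope S →⋆ₙₐ[ℂ] D where
  toFun := Envelope.liftL φ
  map_smul' := map_smul _
  map_zero' := map_zero _
  map_add' := map_add _
  map_mul' x y := by
    refine Envelope.denseRange_mk.induction_on₂
      (p := fun x y => Envelope.liftL φ (x * y) = Envelope.liftL φ x * Envelope.liftL φ y)
      (isClosed_eq (by fun_prop) (by fun_prop)) (fun x y => ?_) x y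
    rw [← map_mul, Envelope.liftL_mk, Envelope.liftL_mk, Envelope.liftL_mk, map_mul]
  map_star' x := by
    refine Envelope.denseRange_mk.induction_on
      (p := fun x => Envelope.liftL φ (star x) = star (Envelope.liftL φ x)) x
      (isClosed_eq ((Envelope.liftL φ).continuous.comp continuous_star) (by fun_prop)) (fun x => ?_)
    rw [← map_star, Envelope.liftL_mk, Envelope.liftL_mk, map_star]

theorem Envelope.lift_mk (φ : S →⋆ₙₐ[ℂ] D) (x : S) : Envelope.lift φ (Envelope.mk S x) = φ x :=
  Envelope.liftL_mk φ x

/-- Continuity need not be assumed: a *-homomorphism of C*-algebras is contractive, so density of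
the image of `S` is enough. -/
theorem Envelope.hom_ext {φ ψ : Envelope S →⋆ₙₐ[ℂ] D}
    (h : ∀ x, φ (Envelope.mk S x) = ψ (Envelope.mk S x)) : φ = ψ := by
  have hc : ∀ φ : Envelope S →⋆ₙₐ[ℂ] D, Continuous φ := fun φ =>
    AddMonoidHomClass.continuous_of_bound φ 1 fun x => by
      rw [one_mul]; exact NonUnitalStarAlgHom.norm_apply_le φ x
  exact DFunLike.coe_injective (Envelope.denseRange_mk.equalizer (hc φ) (hc ψ) (funext h))

end Envelope

/-! ### Homomorphisms on algebraic tensor products of *-algebras. -/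

section TensorLift

variable {S T D : Type*} [NonUnitalRing S] [StarRing S] [Module ℂ S] [IsScalarTower ℂ S S]
  [SMulCommClass ℂ S S] [StarModule ℂ S] [NonUnitalRing T] [StarRing T] [Module ℂ T]
  [IsScalarTower ℂ T T] [SMulCommClass ℂ T T] [StarModule ℂ T] [NonUnitalRing D] [StarRing D]
  [Module ℂ D] [StarModule ℂ D]

/-- The *-homomorphism on an algebraic tensor product defined by a multiplicative and
*-preserving bilinear map. -/
def tensorLift (β : S →ₗ[ℂ] T →ₗ[ℂ] D) (hmul : ∀ x x' y y', β (x * x') (y * y') = β x y * β x' y')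
    (hstar : ∀ x y, β (star x) (star y) = star (β x y)) : S ⊗[ℂ] T →⋆ₙₐ[ℂ] D where
  toFun := TensorProduct.lift β
  map_smul' := map_smul _
  map_zero' := map_zero _
  map_add' := map_add _
  map_mul' x y := by
    induction x with
    | zero => simp
    | add x x' hx hx' => simp only [add_mul, map_add, hx, hx']
    | tmul a b =>
      induction y with
      | zero => simp
      | add x x' hx hx' => simp only [mul_add, map_add, hx, hx']
      | tmul a' b' => simp [hmul]
  map_star' x := by
    induction x with
    | zero => simp
    | add x x' hx hx' => simp only [star_add, map_add, hx, hx']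
    | tmul a b => simp [hstar]

theorem tensorLift_tmul (β : S →ₗ[ℂ] T →ₗ[ℂ] D)
    (hmul : ∀ x x' y y', β (x * x') (y * y') = β x y * β x' y')
    (hstar : ∀ x y, β (star x) (star y) = star (β x y)) (x : S) (y : T) :
    tensorLift β hmul hstar (x ⊗ₜ y) = β x y := TensorProduct.lift.tmul x y

end TensorLift

/-! ### Actions of section algebras -/

section Action

variable {X : Type*} [NonUnitalRing X] [StarRing X] [Module ℂ X]
  [IsScalarTower ℂ X X] [SMulCommClass ℂ X X] [StarModule ℂ X] (p : CStarSeminorm X)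

theorem CStarSeminorm.form_apply (x y : X) :
    p.form x y = CStarSeminorm.Completion.mk p (star x * y) := rfl

variable [PartialOrder p.Completion] [StarOrderedRing p.Completion]

theorem CStarSeminorm.form_nonneg (x : X) : 0 ≤ p.form x x := by
  rw [p.form_apply, CStarSeminorm.Completion.mk_mul, CStarSeminorm.Completion.mk_star]
  exact star_mul_self_nonneg _

/-- The right action demanded by `IsPosForm` is multiplication within `X` itself: `u* x · x* y = u*
(x x* y)`. This makes the general results on positive forms available for `(x, y) ↦ x* y`. -/
theorem CStarSeminorm.isPosForm_form : IsPosForm p.form where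
  nonneg := p.form_nonneg
  star_eq x y := by
    rw [p.form_apply, p.form_apply, ← CStarSeminorm.Completion.mk_star, star_mul, star_star]
  right x y := ⟨x * (star x * y), fun u => by
    rw [p.form_apply, p.form_apply, p.form_apply, ← CStarSeminorm.Completion.mk_mul, mul_assoc]⟩

/-- Both sides are nonnegative with square the norm of `x* x`, by the C*-identity for `p`. Thus
estimates for the form are estimates for `p`. -/
theorem CStarSeminorm.seminorm_form (x : X) :
    p.isPosForm_form.seminorm x = p.toSeminorm x := by
  have h := p.isPosForm_form.seminorm_sq x
  rw [← p.sq_eq_norm_form] at h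
  exact (sq_eq_sq₀ (apply_nonneg _ _) (apply_nonneg _ _)).mp h

end Action

/-! ### Bounded actions of section algebras and the cross inequality. -/

namespace FellBundle.Sections

variable {G : Type u} [Group G] (A : FellBundle.{u, v} G) {X : Type*} [NonUnitalRing X]
  [StarRing X] [Module ℂ X] [IsScalarTower ℂ X X] [SMulCommClass ℂ X X] [StarModule ℂ X]
  (p : CStarSeminorm X) (L : A.Sections →ₗ[ℂ] X →ₗ[ℂ] X)

/-- The unit fiber is a C*-algebra, so its adjointable action is contractive by `action_bound`. For
`a` in another fiber, `a* a` lies in the unit fiber and controls `L a`. A general section is a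
finite sum of such elements. The constant is irrelevant: mere boundedness is what
`IsPosForm.action_le` requires. -/
theorem exists_action_bound (hL : ∀ a b x, L (a * b) x = L a (L b x))
    (hI : ∀ a x y, star (L a x) * y = star x * L (star a) y) (a : A.Sections) :
    ∃ C, ∀ x, p.toSeminorm (L a x) ≤ C * p.toSeminorm x := by
  let _ := CStarAlgebra.spectralOrder p.Completion
  have _ := CStarAlgebra.spectralOrderedRing p.Completion
  have hunit : ∀ (c : A.UnitFiber) x,
      -- Restricted along `single A 1`, the action becomes an action of the C*-algebra
      -- `A.UnitFiber`; the hypotheses of `action_bound` are those on `L`, rewritten with the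
      -- product and the involution of the unit fiber.
      p.toSeminorm (L (single A 1 c) x) ≤ ‖c‖ * p.toSeminorm x := fun c x => by
    have h := action_bound (A := A.UnitFiber) (L ∘ₗ single A 1)
      (fun a b x => by
        have := hL (single A 1 a) (single A 1 b) x
        rwa [single_mul A (mul_one 1) (a : A.fiber 1) (b : A.fiber 1)] at this)
      p.form
      (fun a x y => congrArg (CStarSeminorm.Completion.mk p) (by
        have := hI (single A 1 a) x y
        rwa [star_single A inv_one (a : A.fiber 1)] at this))
      p.form_nonneg c x
    rw [← p.sq_eq_norm_form, ← p.sq_eq_norm_form, ← mul_pow] at h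
    exact le_of_sq_le_sq h (by positivity)
  refine ind A a ⟨0, fun x => by simp⟩ (fun t a => ?_) (fun a b ha hb => ?_)
  -- `c` is `a* a`, moved into the unit fiber; the bound `√‖c‖` is `‖a‖`, by the C*-identity of the
  -- bundle.
  · let c : A.UnitFiber := A.mul (inv_mul_cancel t) (A.invol rfl a) a
    refine ⟨√‖c‖, fun x => le_of_sq_le_sq ?_ (by positivity)⟩
    -- Adjointability gathers both factors into `a* a = c`, so that `p (L a x)² = p (x* · L c x) ≤ p
    -- x · ‖c‖ p x`.
    have h1 : star (L (single A t a) x) * L (single A t a) x = star x * L (single A 1 c) x := by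
      rw [hI, ← hL, star_single A rfl, single_mul A (inv_mul_cancel t)]
    rw [← p.map_star_mul_self, h1, mul_pow, Real.sq_sqrt (norm_nonneg _)]
    refine (p.map_mul_le _ _).trans ?_
    rw [p.map_star]
    calc _ ≤ p.toSeminorm x * (‖c‖ * p.toSeminorm x) :=
          mul_le_mul_of_nonneg_left (hunit c x) (apply_nonneg _ _)
      _ = _ := by ring
  · obtain ⟨c, hc⟩ := ha
    obtain ⟨d, hd⟩ := hb
    refine ⟨c + d, fun x => ?_⟩
    rw [map_add, LinearMap.add_apply, add_mul]
    exact (map_add_le_add _ _ _).trans (add_le_add (hc x) (hd x))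

/-- Once the operators are bounded, `a ↦ ‖L a‖` on the completion of `X` is a C*-seminorm of
sections, hence at most the greatest one. The unspecified bounds of `exists_action_bound` thereby
become the sharp constant. -/
theorem action_le (hL : ∀ a b x, L (a * b) x = L a (L b x))
    (hI : ∀ a x y, star (L a x) * y = star x * L (star a) y) (a : A.Sections) (x : X) :
    p.toSeminorm (L a x) ≤ (CStarSeminorm.greatest A.Sections).toSeminorm a * p.toSeminorm x := by
  let _ := CStarAlgebra.spectralOrder p.Completion
  have _ := CStarAlgebra.spectralOrderedRing p.Completion
  have h := p.isPosForm_form.action_le L hL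
    (fun a x y => congrArg (CStarSeminorm.Completion.mk p) (hI a x y))
    (fun a => by simpa only [p.seminorm_form] using exists_action_bound A p L hL hI a) a x
  simpa only [p.seminorm_form] using h

/-- Every C*-seminorm on the algebraic tensor product of two section algebras is a cross
seminorm for the greatest C*-seminorms of the factors. -/
theorem seminorm_tmul_le {H : Type u'} [Group H] (B : FellBundle.{u', v'} H)
    (p : CStarSeminorm (A.Sections ⊗[ℂ] B.Sections)) (a : A.Sections) (b : B.Sections) :
    p.toSeminorm (a ⊗ₜ b) ≤ (CStarSeminorm.greatest A.Sections).toSeminorm a *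
      (CStarSeminorm.greatest B.Sections).toSeminorm b := by
  -- The action is `x ⊗ y ↦ a x ⊗ y`, left multiplication by the possibly missing element `a ⊗ 1`.
  -- Its adjoint for `(x, y) ↦ x* y` is the action of `a*`.
  have hA : ∀ (a a' : A.Sections) (b : B.Sections), p.toSeminorm ((a * a') ⊗ₜ b) ≤
      (CStarSeminorm.greatest A.Sections).toSeminorm a * p.toSeminorm (a' ⊗ₜ b) :=
    fun a a' b => action_le A p
      ((TensorProduct.mapBilinear (RingHom.id ℂ) A.Sections B.Sections A.Sections B.Sections).flip
        LinearMap.id ∘ₗ LinearMap.mul ℂ A.Sections)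
      (fun a b x => by
        induction x with
        | zero => simp
        | tmul x y => simp [mul_assoc]
        | add x y hx hy => simp only [map_add, hx, hy])
      (fun a x y => by
        induction x with
        | zero => simp
        | add x x' hx hy => simp only [map_add, star_add, add_mul, hx, hy]
        | tmul x x' =>
          induction y with
          | zero => simp
          | tmul y y' => simp [mul_assoc]
          | add x y hx hy => simp only [map_add, mul_add, hx, hy]) a (a' ⊗ₜ b)
  -- The same with `1 ⊗ b` in place of `a ⊗ 1`.
  have hB : ∀ (a : A.Sections) (b b' : B.Sections), p.toSeminorm (a ⊗ₜ (b * b')) ≤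
      (CStarSeminorm.greatest B.Sections).toSeminorm b * p.toSeminorm (a ⊗ₜ b') :=
    fun a b b' => action_le B p
      (TensorProduct.mapBilinear (RingHom.id ℂ) A.Sections B.Sections A.Sections B.Sections
        LinearMap.id ∘ₗ LinearMap.mul ℂ B.Sections)
      (fun a b x => by
        induction x with
        | zero => simp
        | tmul x y => simp [mul_assoc]
        | add x y hx hy => simp only [map_add, hx, hy])
      (fun a x y => by
        induction x with
        | zero => simp
        | add x x' hx hy => simp only [map_add, star_add, add_mul, hx, hy]
        | tmul x x' =>
          induction y with
          | zero => simp
          | tmul y y' => simp [mul_assoc]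
          | add x y hx hy => simp only [map_add, mul_add, hx, hy]) b (a ⊗ₜ b')
  have h2 : p.toSeminorm ((star a * a) ⊗ₜ[ℂ] (star b * b)) = p.toSeminorm (a ⊗ₜ b) ^ 2 := by
    simpa using p.map_star_mul_self (a ⊗ₜ b)
  -- Split off `a*` and then `b*` from `a* a ⊗ b* b`. What remains is `a ⊗ b`, so `h2` turns this
  -- into `r² ≤ ‖a‖ ‖b‖ r`, to be divided by `r`.
  have h4 := (hA (star a) a (star b * b)).trans
    (mul_le_mul_of_nonneg_left (hB a (star b) b) (apply_nonneg _ _))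
  rw [h2, CStarSeminorm.map_star, CStarSeminorm.map_star] at h4
  set r := p.toSeminorm (a ⊗ₜ[ℂ] b)
  -- Division needs `r > 0`; for `r = 0` the bound is trivial.
  rcases (apply_nonneg p.toSeminorm (a ⊗ₜ[ℂ] b)).eq_or_lt with h0 | h0
  · change 0 = r at h0
    rw [← h0]
    exact mul_nonneg (apply_nonneg _ _) (apply_nonneg _ _)
  · exact le_of_mul_le_mul_right (by rw [mul_assoc, ← sq]; exact h4) h0

/-! ### Homomorphisms from representations of a Fell bundle. -/

/-- The *-homomorphism on sections defined by a representation of the Fell bundle. -/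
def liftHom {D : Type*} [NonUnitalRing D] [StarRing D] [Module ℂ D] [StarModule ℂ D]
    (f : ∀ t, A.fiber t →ₗ[ℂ] D)
    (hmul : ∀ {t s r : G} (h : t * s = r) a b, f r (A.mul h a b) = f t a * f s b)
    (hstar : ∀ {t r : G} (h : t⁻¹ = r) a, f r (A.invol h a) = star (f t a)) :
    A.Sections →⋆ₙₐ[ℂ] D where
  toFun := lift A f
  map_smul' := map_smul _
  map_zero' := map_zero _
  map_add' := map_add _
  map_mul' x y := by
    refine ind A x (by simp) (fun t a => ?_)
      (fun x x' hx hx' => by simp only [add_mul, map_add, hx, hx'])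
    refine ind A y (by simp) (fun s b => ?_)
      (fun x x' hx hx' => by simp only [mul_add, map_add, hx, hx'])
    rw [single_mul A rfl, lift_single, lift_single, lift_single, hmul]
  map_star' x := by
    refine ind A x (by simp) (fun t a => ?_)
      (fun x x' hx hx' => by simp only [star_add, map_add, hx, hx'])
    rw [star_single A rfl, lift_single, lift_single, hstar]

theorem liftHom_single {D : Type*} [NonUnitalRing D] [StarRing D] [Module ℂ D] [StarModule ℂ D]
    (f : ∀ t, A.fiber t →ₗ[ℂ] D)
    (hmul : ∀ {t s r : G} (h : t * s = r) a b, f r (A.mul h a b) = f t a * f s b)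
    (hstar : ∀ {t r : G} (h : t⁻¹ = r) a, f r (A.invol h a) = star (f t a)) (t : G)
    (a : A.fiber t) : liftHom A f hmul hstar (single A t a) = f t a := lift_single A f t a

end FellBundle.Sections

/-! ### The canonical representation of a bundle in its full cross-sectional algebra. -/

namespace FellBundle

variable {G : Type u} [Group G] {H : Type u'} [Group H]
  (A : FellBundle.{u, v} G) (B : FellBundle.{u', v'} H)

theorem toFullCStar_mul {t s r : G} (h : t * s = r) (a : A.fiber t) (b : A.fiber s) :
    A.toFullCStar r (A.mul h a b) = A.toFullCStar t a * A.toFullCStar s b :=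
  (congrArg (Envelope.mk A.Sections) (Sections.single_mul A h a b).symm).trans
    (map_mul (Envelope.mk A.Sections) _ _)

theorem toFullCStar_invol {t r : G} (h : t⁻¹ = r) (a : A.fiber t) :
    A.toFullCStar r (A.invol h a) = star (A.toFullCStar t a) :=
  (congrArg (Envelope.mk A.Sections) (Sections.star_single A h a).symm).trans
    (map_star (Envelope.mk A.Sections) _)

/-- Sections are finite sums of elements of fibers, and they are dense. -/
theorem fullCStar_hom_ext {D : Type*} [NonUnitalCStarAlgebra D] {φ ψ : A.FullCStar →⋆ₙₐ[ℂ] D}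
    (h : ∀ t a, φ (A.toFullCStar t a) = ψ (A.toFullCStar t a)) : φ = ψ :=
  Envelope.hom_ext fun x => by
    refine Sections.ind A x (by simp) h (fun x y hx hy => ?_)
    rw [map_add, map_add, map_add, hx, hy]

/-! ### The homomorphism of `C*(A ⊗ B)` to `C*(A) ⊗ C*(B)` -/

/-- The maximal tensor product `C*(A) ⊗_max C*(B)`. -/
abbrev FullTensor : Type (max u v u' v') := MaxTensorProduct A.FullCStar B.FullCStar

/-! Shortcuts for instance search. -/

local instance : NonUnitalCStarAlgebra (FullTensor A B) := inferInstance
local instance : NonUnitalNormedRing (FullTensor A B) := inferInstance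
local instance : NonUnitalRing (FullTensor A B) := inferInstance
local instance : NormedAddCommGroup (FullTensor A B) := inferInstance
local instance : SeminormedAddCommGroup (FullTensor A B) := inferInstance
local instance : AddCommGroup (FullTensor A B) := inferInstance
local instance : AddCommMonoid (FullTensor A B) := inferInstance
local instance : Norm (FullTensor A B) := inferInstance
local instance : TopologicalSpace (FullTensor A B) := inferInstance
local instance : T2Space (FullTensor A B) := inferInstance
local instance : StarRing (FullTensor A B) := inferInstance
local instance : CStarRing (FullTensor A B) := inferInstance
local instance : Star (FullTensor A B) := inferInstance
local instance : Mul (FullTensor A B) := inferInstance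
local instance : Module ℂ (FullTensor A B) := inferInstance

/-- The canonical map of `A_t ⊙ B_s` to `C*(A) ⊗_max C*(B)`. -/
def algToFull (p : G × H) : AlgFiber A B p →ₗ[ℂ] FullTensor A B :=
  (MaxTensorProduct.mk A.FullCStar B.FullCStar).comp
    (TensorProduct.map (A.toFullCStar p.1) (B.toFullCStar p.2))

theorem algToFull_tmul (p : G × H) (a : A.fiber p.1) (b : B.fiber p.2) :
    algToFull A B p (a ⊗ₜ b) =
      Envelope.mk (A.FullCStar ⊗[ℂ] B.FullCStar) (A.toFullCStar p.1 a ⊗ₜ B.toFullCStar p.2 b) :=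
  rfl

theorem algToFull_algMul {p q r : G × H} (h : p * q = r) (x : AlgFiber A B p)
    (y : AlgFiber A B q) :
    algToFull A B r (algMul A B h x y) = algToFull A B p x * algToFull A B q y := by
  induction x using TensorProduct.induction_on with
  | zero => simp
  | add a a' ha ha' => simp only [map_add, LinearMap.add_apply, ha, ha', add_mul]
  | tmul a a' =>
    induction y using TensorProduct.induction_on with
    | zero => simp
    | add a a' ha ha' => simp only [map_add, ha, ha', mul_add]
    | tmul b b' =>
      rw [algMul_tmul, algToFull_tmul, algToFull_tmul, algToFull_tmul, ← map_mul,
        Algebra.TensorProduct.tmul_mul_tmul, toFullCStar_mul, toFullCStar_mul]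

theorem algToFull_algInvol {p r : G × H} (h : p⁻¹ = r) (x : AlgFiber A B p) :
    algToFull A B r (algInvol A B h x) = star (algToFull A B p x) := by
  induction x using TensorProduct.induction_on with
  | zero => simp
  | add a a' ha ha' => simp only [map_add, ha, ha', star_add]
  | tmul a a' =>
    rw [algInvol_tmul, algToFull_tmul, algToFull_tmul, ← map_star, TensorProduct.star_tmul,
      toFullCStar_invol, toFullCStar_invol]

/-- The canonical *-homomorphism of `A_e ⊙ B_e` to `C*(A) ⊗_max C*(B)`. -/
def algUnitToFull : AlgUnit A B →⋆ₙₐ[ℂ] FullTensor A B where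
  toFun x := algToFull A B 1 ((toAlgUnit A B).symm x)
  map_smul' c x := by simp
  map_zero' := by simp
  map_add' x y := by simp
  map_mul' x y := by
    obtain ⟨x, rfl⟩ := (toAlgUnit A B).surjective x
    obtain ⟨y, rfl⟩ := (toAlgUnit A B).surjective y
    rw [← toAlgUnit_mul]
    simp only [LinearEquiv.symm_apply_apply, algToFull_algMul]
  map_star' x := by
    obtain ⟨x, rfl⟩ := (toAlgUnit A B).surjective x
    rw [← toAlgUnit_star]
    simp only [LinearEquiv.symm_apply_apply, algToFull_algInvol]

/-- The norm of the fiber is designed for this: by the C*-identity in the target only `x* x ∈ A_e ⊙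
B_e` has to be estimated, and there the canonical map is a *-homomorphism into a C*-algebra, hence
dominated by the maximal C*-norm, whose value at `x* x` is `maxNorm A B p x ^ 2`. -/
theorem norm_algToFull_le (p : G × H) (x : AlgFiber A B p) :
    ‖algToFull A B p x‖ ≤ maxNorm A B p x := by
  have h1 := norm_le_greatest (algUnitToFull A B) (algInner A B p x x)
  have h2 : algUnitToFull A B (algInner A B p x x) =
      star (algToFull A B p x) * algToFull A B p x := by
    -- Return from the *-algebra `AlgUnit A B` to the fiber over `1`, where `x* x` is a product of
    -- elements over `p⁻¹` and `p` and `algToFull` is multiplicative across fibers.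
    rw [← algInner_eq A B rfl (inv_mul_cancel p), ← algToFull_algInvol A B rfl,
      ← algToFull_algMul A B (inv_mul_cancel p)]
    exact congrArg (algToFull A B 1) (LinearEquiv.symm_apply_apply _ _)
  rw [h2, CStarRing.norm_star_mul_self, ← sq] at h1
  exact le_of_sq_le_sq (h1.trans (maxNormUnit_algInner A B p x).le) (apply_nonneg _ _)

/-- The canonical map of `A_t ⊗_max B_s` to `C*(A) ⊗_max C*(B)`. -/
def maxToFull (p : G × H) : MaxFiber A B p →L[ℂ] FullTensor A B :=
  (algToFull A B p).extendOfNorm (Hull.mk (maxNorm A B p))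

theorem maxToFull_mk (p : G × H) (x : AlgFiber A B p) :
    maxToFull A B p (Hull.mk _ x) = algToFull A B p x :=
  LinearMap.extendOfNorm_eq (Hull.denseRange_mk _) ⟨1, fun x => by
    rw [one_mul, Hull.norm_mk]
    exact norm_algToFull_le A B p x⟩ x

theorem maxToFull_maxMul {p q r : G × H} (h : p * q = r) (x : MaxFiber A B p)
    (y : MaxFiber A B q) :
    maxToFull A B r (maxMul A B h x y) = maxToFull A B p x * maxToFull A B q y := by
  refine Hull.ind₂ (P := fun x y => maxToFull A B r (maxMul A B h x y) =
    maxToFull A B p x * maxToFull A B q y) (isClosed_eq (by fun_prop) ?_) (fun x y => ?_) x y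
  · exact ((maxToFull A B p).continuous.comp continuous_fst).mul
      ((maxToFull A B q).continuous.comp continuous_snd)
  · rw [maxMul_mk, maxToFull_mk, maxToFull_mk, maxToFull_mk, algToFull_algMul]

theorem maxToFull_maxInvol {p r : G × H} (h : p⁻¹ = r) (x : MaxFiber A B p) :
    maxToFull A B r (maxInvol A B h x) = star (maxToFull A B p x) := by
  refine Hull.ind (P := fun x => maxToFull A B r (maxInvol A B h x) = star (maxToFull A B p x))
    (isClosed_eq (by fun_prop) (maxToFull A B p).continuous.star) (fun x => ?_) x
  rw [maxInvol_mk, maxToFull_mk, maxToFull_mk, algToFull_algInvol]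

/-- The canonical *-homomorphism of `C*(A ⊗_max B)` to `C*(A) ⊗_max C*(B)`. -/
def tensorToFull : (A.maxTensor B).FullCStar →⋆ₙₐ[ℂ] FullTensor A B :=
  Envelope.lift (Sections.liftHom (A.maxTensor B) (fun p => (maxToFull A B p).toLinearMap)
    (maxToFull_maxMul A B) (maxToFull_maxInvol A B))

theorem tensorToFull_tmul (t : G) (s : H) (a : A.fiber t) (b : B.fiber s) :
    tensorToFull A B ((A.maxTensor B).toFullCStar (t, s) (A.maxTensorMk B t s (a ⊗ₜ b))) =
      MaxTensorProduct.mk A.FullCStar B.FullCStar (A.toFullCStar t a ⊗ₜ B.toFullCStar s b) :=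
  (Envelope.lift_mk _ _).trans ((Sections.liftHom_single (A.maxTensor B) _ _ _ _ _).trans
    (maxToFull_mk A B (t, s) (a ⊗ₜ b)))

/-- A *-homomorphism on `C*(A ⊗_max B)` is determined by its values at elementary tensors. -/
theorem maxTensor_hom_ext {D : Type*} [NonUnitalCStarAlgebra D]
    {φ ψ : (A.maxTensor B).FullCStar →⋆ₙₐ[ℂ] D}
    (h : ∀ t s a b, φ ((A.maxTensor B).toFullCStar (t, s) (A.maxTensorMk B t s (a ⊗ₜ b))) =
      ψ ((A.maxTensor B).toFullCStar (t, s) (A.maxTensorMk B t s (a ⊗ₜ b)))) : φ = ψ := by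
  -- Fibers map contractively to the enveloping algebra and `φ` is contractive, so equality on a
  -- completed fiber can be tested on the dense image of `A_t ⊙ B_s`.
  have hc : ∀ (φ : (A.maxTensor B).FullCStar →⋆ₙₐ[ℂ] D) (p : G × H),
      Continuous fun x : MaxFiber A B p => φ ((A.maxTensor B).toFullCStar p x) := fun φ p =>
    AddMonoidHomClass.continuous_of_bound
      ((φ : (A.maxTensor B).FullCStar →ₗ[ℂ] D).comp ((A.maxTensor B).toFullCStar p)) 1 fun x => by
      rw [one_mul]
      refine (NonUnitalStarAlgHom.norm_apply_le φ _).trans ?_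
      exact (CStarSeminorm.Completion.norm_mk _ _).le.trans (Sections.seminorm_single_le _ _ _ _)
  refine fullCStar_hom_ext _ fun p x => ?_
  refine Hull.ind (P := fun x : MaxFiber A B p => φ ((A.maxTensor B).toFullCStar p x) =
    ψ ((A.maxTensor B).toFullCStar p x)) (isClosed_eq (hc φ p) (hc ψ p)) (fun x => ?_) x
  -- On `A_t ⊙ B_s` both maps are linear, hence determined by elementary tensors.
  have hlin : ((φ : (A.maxTensor B).FullCStar →ₗ[ℂ] D).comp ((A.maxTensor B).toFullCStar p)).comp
      (A.maxTensorMk B p.1 p.2) = ((ψ : (A.maxTensor B).FullCStar →ₗ[ℂ] D).comp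
      ((A.maxTensor B).toFullCStar p)).comp (A.maxTensorMk B p.1 p.2) :=
    TensorProduct.ext' (h p.1 p.2)
  exact LinearMap.congr_fun hlin x

/-! ### The homomorphism of `C*(A) ⊗ C*(B)` to `C*(A ⊗ B)` -/

/-- The canonical bilinear map from sections of `A` and `B` to sections of `A ⊗_max B`. -/
def sectionsTensor : A.Sections →ₗ[ℂ] B.Sections →ₗ[ℂ] (A.maxTensor B).Sections :=
  -- `Sections.lift` extends in the first variable only, so the arguments are flipped to extend in
  -- `B` and flipped back to extend in `A`.
  Sections.lift A fun t => LinearMap.flip (Sections.lift B fun s => LinearMap.flip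
    ((TensorProduct.mk ℂ (A.fiber t) (B.fiber s)).compr₂
      ((Sections.single (A.maxTensor B) (t, s)).comp (A.maxTensorMk B t s))))

theorem sectionsTensor_single (t : G) (s : H) (a : A.fiber t) (b : B.fiber s) :
    sectionsTensor A B (Sections.single A t a) (Sections.single B s b) =
      Sections.single (A.maxTensor B) (t, s) (A.maxTensorMk B t s (a ⊗ₜ b)) := by
  simp [sectionsTensor, Sections.lift_single]

/-- By linearity in all four variables only elements of fibers matter. For these it is the product
rule of the tensor product bundle; `(t, s) * (t', s')` is `(t * t', s * s')` by definition, so no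
transport between fibers occurs. -/
theorem sectionsTensor_mul (x x' : A.Sections) (y y' : B.Sections) :
    sectionsTensor A B (x * x') (y * y') = sectionsTensor A B x y * sectionsTensor A B x' y' := by
  refine Sections.ind A x (by simp) (fun t a => ?_)
    (fun x x' hx hx' => by simp only [add_mul, map_add, LinearMap.add_apply, hx, hx'])
  refine Sections.ind A x' (by simp) (fun t' a' => ?_)
    (fun x x' hx hx' => by simp only [mul_add, map_add, LinearMap.add_apply, hx, hx'])
  refine Sections.ind B y (by simp) (fun s b => ?_)
    (fun x x' hx hx' => by simp only [add_mul, map_add, hx, hx'])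
  refine Sections.ind B y' (by simp) (fun s' b' => ?_)
    (fun x x' hx hx' => by simp only [mul_add, map_add, hx, hx'])
  rw [Sections.single_mul A rfl, Sections.single_mul B rfl, sectionsTensor_single,
    sectionsTensor_single, sectionsTensor_single, Sections.single_mul (A.maxTensor B) rfl]
  exact congrArg (Sections.single (A.maxTensor B) _)
    (maxMul_mk A B (p := (t, s)) (q := (t', s')) rfl (a ⊗ₜ b) (a' ⊗ₜ b')).symm

theorem sectionsTensor_star (x : A.Sections) (y : B.Sections) :
    sectionsTensor A B (star x) (star y) = star (sectionsTensor A B x y) := by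
  refine Sections.ind A x (by simp) (fun t a => ?_)
    (fun x x' hx hx' => by simp only [star_add, map_add, LinearMap.add_apply, hx, hx'])
  refine Sections.ind B y (by simp) (fun s b => ?_)
    (fun x x' hx hx' => by simp only [star_add, map_add, hx, hx'])
  rw [Sections.star_single A rfl, Sections.star_single B rfl, sectionsTensor_single,
    sectionsTensor_single, Sections.star_single (A.maxTensor B) rfl]
  exact congrArg (Sections.single (A.maxTensor B) _)
    (maxInvol_mk A B (p := (t, s)) rfl (a ⊗ₜ b)).symm

/-- The greatest C*-seminorm of the target pulls back along the *-homomorphism given by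
`sectionsTensor` to a C*-seminorm on the tensor product of the section algebras, so the cross
inequality applies. This is what lets the bilinear map extend to the enveloping algebras. -/
theorem sectionsTensor_le (x : A.Sections) (y : B.Sections) :
    (CStarSeminorm.greatest (A.maxTensor B).Sections).toSeminorm (sectionsTensor A B x y) ≤
      (CStarSeminorm.greatest A.Sections).toSeminorm x *
        (CStarSeminorm.greatest B.Sections).toSeminorm y :=
  Sections.seminorm_tmul_le A B ((CStarSeminorm.greatest (A.maxTensor B).Sections).comp
    (tensorLift _ (sectionsTensor_mul A B) (sectionsTensor_star A B))) x y

/-- The canonical bilinear map `C*(A) × C*(B) → C*(A ⊗_max B)`. -/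
def fullTensor : A.FullCStar →L[ℂ] B.FullCStar →L[ℂ] (A.maxTensor B).FullCStar :=
  Hull.extend₂ (sectionsTensor A B) (sectionsTensor_le A B)

theorem fullTensor_mk (x : A.Sections) (y : B.Sections) :
    fullTensor A B (Envelope.mk _ x) (Envelope.mk _ y) =
      Envelope.mk _ (sectionsTensor A B x y) :=
  Hull.extend₂_mk _ (sectionsTensor_le A B) x y

theorem fullTensor_mul (x x' : A.FullCStar) (y y' : B.FullCStar) :
    fullTensor A B (x * x') (y * y') = fullTensor A B x y * fullTensor A B x' y' := by
  have hA := Envelope.denseRange_mk (S := A.Sections)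
  have hB := Envelope.denseRange_mk (S := B.Sections)
  -- Density is used in two rounds: in the two variables from `A`, then in the two from `B`.
  refine hA.induction_on₂ (p := fun x x' => fullTensor A B (x * x') (y * y') =
    fullTensor A B x y * fullTensor A B x' y') (isClosed_eq (by fun_prop) (by fun_prop))
    (fun x x' => ?_) x x'
  refine hB.induction_on₂ (p := fun y y' => fullTensor A B (Envelope.mk _ x * Envelope.mk _ x')
    (y * y') = fullTensor A B (Envelope.mk _ x) y * fullTensor A B (Envelope.mk _ x') y')
    (isClosed_eq (by fun_prop) (by fun_prop)) (fun y y' => ?_) y y'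
  rw [← map_mul, ← map_mul, fullTensor_mk, fullTensor_mk, fullTensor_mk, sectionsTensor_mul,
    map_mul]

theorem fullTensor_star (x : A.FullCStar) (y : B.FullCStar) :
    fullTensor A B (star x) (star y) = star (fullTensor A B x y) := by
  refine Envelope.denseRange_mk.induction_on (p := fun x => fullTensor A B (star x) (star y) =
    star (fullTensor A B x y)) x (isClosed_eq (by fun_prop) (by fun_prop)) (fun x => ?_)
  refine Envelope.denseRange_mk.induction_on (p := fun y => fullTensor A B
    (star (Envelope.mk _ x)) (star y) = star (fullTensor A B (Envelope.mk _ x) y)) y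
    (isClosed_eq (by fun_prop) (by fun_prop)) (fun y => ?_)
  rw [← map_star, ← map_star, fullTensor_mk, fullTensor_mk, sectionsTensor_star, map_star]

/-- The canonical *-homomorphism of `C*(A) ⊗_max C*(B)` to `C*(A ⊗_max B)`. -/
def fullToTensor : FullTensor A B →⋆ₙₐ[ℂ] (A.maxTensor B).FullCStar :=
  Envelope.lift (tensorLift ((ContinuousLinearMap.coeLM ℂ).comp (fullTensor A B).toLinearMap)
    (fullTensor_mul A B) (fullTensor_star A B))

theorem fullToTensor_mk_tmul (x : A.FullCStar) (y : B.FullCStar) :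
    fullToTensor A B (Envelope.mk (A.FullCStar ⊗[ℂ] B.FullCStar) (x ⊗ₜ y)) =
      fullTensor A B x y :=
  (Envelope.lift_mk _ _).trans (tensorLift_tmul _ _ _ x y)

theorem fullToTensor_tmul (t : G) (s : H) (a : A.fiber t) (b : B.fiber s) :
    fullToTensor A B (MaxTensorProduct.mk A.FullCStar B.FullCStar
      (A.toFullCStar t a ⊗ₜ B.toFullCStar s b)) =
      (A.maxTensor B).toFullCStar (t, s) (A.maxTensorMk B t s (a ⊗ₜ b)) :=
  (fullToTensor_mk_tmul A B _ _).trans ((fullTensor_mk A B _ _).trans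
    (congrArg (Envelope.mk _) (sectionsTensor_single A B t s a b)))

/-! ### The two homomorphisms are mutually inverse. -/

theorem fullToTensor_tensorToFull (z : (A.maxTensor B).FullCStar) :
    fullToTensor A B (tensorToFull A B z) = z := by
  have h : (fullToTensor A B).comp (tensorToFull A B) = NonUnitalStarAlgHom.id ℂ _ :=
    maxTensor_hom_ext A B fun t s a b =>
      (congrArg _ (tensorToFull_tmul A B t s a b)).trans (fullToTensor_tmul A B t s a b)
  exact DFunLike.congr_fun h z

/-- The formula is known for `x` and `y` in fibers, but `C*(A) ⊙ C*(B)` has tensors of limits of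
sections too. Both sides are bilinear and separately continuous, so `x` and `y` can be replaced in
turn by sections and then by elements of fibers. -/
theorem tensorToFull_fullTensor (x : A.FullCStar) (y : B.FullCStar) :
    tensorToFull A B (fullTensor A B x y) =
      Envelope.mk (A.FullCStar ⊗[ℂ] B.FullCStar) (x ⊗ₜ y) := by
  have hΦ : Continuous (tensorToFull A B) :=
    AddMonoidHomClass.continuous_of_bound (tensorToFull A B) 1 fun x => by
      rw [one_mul]; exact NonUnitalStarAlgHom.norm_apply_le _ x
  -- Separate continuity of `(x, y) ↦ x ⊗ y` in the maximal tensor product comes from its norm being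
  -- subcross.
  have hbd : ∀ (x : A.FullCStar) (y : B.FullCStar),
      ‖Envelope.mk (A.FullCStar ⊗[ℂ] B.FullCStar) (x ⊗ₜ y)‖ ≤ ‖x‖ * ‖y‖ := fun x y =>
    (CStarSeminorm.Completion.norm_mk _ _).le.trans (CStarSeminorm.map_tmul_le _ x y)
  have hc₁ : ∀ y : B.FullCStar, Continuous fun x : A.FullCStar =>
      Envelope.mk (A.FullCStar ⊗[ℂ] B.FullCStar) (x ⊗ₜ y) := fun y =>
    AddMonoidHomClass.continuous_of_bound ((MaxTensorProduct.mk A.FullCStar B.FullCStar).comp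
      ((TensorProduct.mk ℂ A.FullCStar B.FullCStar).flip y)) ‖y‖ fun x => by
      rw [mul_comm]; exact hbd x y
  have hc₂ : ∀ x : A.FullCStar, Continuous fun y : B.FullCStar =>
      Envelope.mk (A.FullCStar ⊗[ℂ] B.FullCStar) (x ⊗ₜ y) := fun x =>
    AddMonoidHomClass.continuous_of_bound ((MaxTensorProduct.mk A.FullCStar B.FullCStar).comp
      (TensorProduct.mk ℂ A.FullCStar B.FullCStar x)) ‖x‖ (hbd x)
  refine Envelope.denseRange_mk.induction_on (p := fun x => tensorToFull A B (fullTensor A B x y) =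
    Envelope.mk (A.FullCStar ⊗[ℂ] B.FullCStar) (x ⊗ₜ y)) x
    (isClosed_eq (hΦ.comp (by fun_prop)) (hc₁ y)) (fun x => ?_)
  refine Envelope.denseRange_mk.induction_on (p := fun y => tensorToFull A B
    (fullTensor A B (Envelope.mk _ x) y) =
    Envelope.mk (A.FullCStar ⊗[ℂ] B.FullCStar) (Envelope.mk _ x ⊗ₜ y)) y
    (isClosed_eq (hΦ.comp (by fun_prop)) (hc₂ _)) (fun y => ?_)
  rw [fullTensor_mk]
  refine Sections.ind A x (by simp) (fun t a => ?_) (fun x x' hx hx' => by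
    simp only [map_add, LinearMap.add_apply, TensorProduct.add_tmul, hx, hx'])
  refine Sections.ind B y (by simp) (fun s b => ?_) (fun x x' hx hx' => by
    simp only [map_add, TensorProduct.tmul_add, hx, hx'])
  rw [sectionsTensor_single]
  exact tensorToFull_tmul A B t s a b

/-- The images of `x ⊗ y`, with `x` and `y` in the full algebras, span a dense subspace, and on them
the composite is computed by `tensorToFull_fullTensor`. -/
theorem tensorToFull_fullToTensor (z : FullTensor A B) :
    tensorToFull A B (fullToTensor A B z) = z := by
  have h : (tensorToFull A B).comp (fullToTensor A B) = NonUnitalStarAlgHom.id ℂ _ :=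
    Envelope.hom_ext fun z => by
      induction z with
      | zero => simp
      | add x y hx hy => rw [map_add, map_add, map_add, hx, hy]
      | tmul x y =>
        exact (congrArg _ (fullToTensor_mk_tmul A B x y)).trans (tensorToFull_fullTensor A B x y)
  exact DFunLike.congr_fun h z

/-- The canonical *-isomorphism of `C*(A ⊗_max B)` and `C*(A) ⊗_max C*(B)`. -/
def tensorEquivFull : (A.maxTensor B).FullCStar ≃⋆ₐ[ℂ] FullTensor A B :=
  StarAlgEquiv.ofBijective (tensorToFull A B)
    ⟨Function.LeftInverse.injective (fullToTensor_tensorToFull A B),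
      Function.RightInverse.surjective (tensorToFull_fullToTensor A B)⟩

end FellBundle

end

theorem mainTheorem5 {G : Type u} {H : Type u'} [Group G] [Group H]
    (A : FellBundle.{u, v} G) (B : FellBundle.{u', v'} H) :
    ∃! Φ : (A.maxTensor B).FullCStar ≃⋆ₐ[ℂ] MaxTensorProduct A.FullCStar B.FullCStar,
      ∀ (t : G) (s : H) (a : A.fiber t) (b : B.fiber s),
        Φ ((A.maxTensor B).toFullCStar (t, s) (A.maxTensorMk B t s (a ⊗ₜ[ℂ] b))) =
          MaxTensorProduct.mk A.FullCStar B.FullCStar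
            (A.toFullCStar t a ⊗ₜ[ℂ] B.toFullCStar s b) := by
  refine ⟨A.tensorEquivFull B, A.tensorToFull_tmul B, fun Ψ hΨ => ?_⟩
  -- Uniqueness holds already among *-homomorphisms, so bijectivity of `Ψ` is forgotten in order to
  -- apply `maxTensor_hom_ext`.
  let ψ : (A.maxTensor B).FullCStar →⋆ₙₐ[ℂ] MaxTensorProduct A.FullCStar B.FullCStar :=
    { toFun := Ψ
      map_smul' := map_smul Ψ
      map_zero' := map_zero Ψ
      map_add' := map_add Ψ
      map_mul' := map_mul Ψ
      map_star' := map_star Ψ }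
  have h : ψ = A.tensorToFull B := A.maxTensor_hom_ext B fun t s a b =>
    (hΨ t s a b).trans (A.tensorToFull_tmul B t s a b).symm
  exact DFunLike.ext _ _ fun x => DFunLike.congr_fun h x
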